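/- **Setting.** There are $m\ge 2$ parties $P_1,\dots,P_m$ with private bit strings $x_1,\dots,x_m$. For each value $\kappa$ of the security parameter fix a finite field $\mathbb F=\mathbb F_\kappa$ with an injective binary encoding. Algorithms are probabilistic programs independent of $\kappa$; arithmetic and uniform sampling in $\mathbb F$ are elementary steps. Two ensembles indexed by $\kappa$ and by inputs $\mathbf x$ are *computationally indistinguishable* ($\overset{c}{\approx}$) if every polynomial-time probabilistic distinguisher with arbitrary advice, given $1^\kappa$, has an advantage that is at most a negligible function of $\kappa$, uniformly in all $\mathbf x$ of length bounded by a given polynomial in $\kappa$; they are *statistically indistinguishable* if their total variation distance $\Delta$ is negligible in the same sense. $[r]=(r_1,\dots,r_m)$ denotes an additive sharing of $r=\sum_i r_i$. **Functionalities.** For a predicate $Q$ of the inputs of a nonempty set $S$ of parties, $\mathcal F^Q_{\mathsf{PZS}}$ gives each party of $S$ a share; the shares are uniform subject to having sum $0$ if $Q(\mathbf x)=1$, and uniform without constraint if $Q(\mathbf x)=0$. A *relaxed* predicative zero-sharing $\mathcal F^Q_{\mathsf{rPZS}}$ is any probabilistic polynomial-time functionality which gives each party of $S$ a share and a hint (an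 additional datum), such that (correctness) the vector of shares is statistically indistinguishable from the output of $\mathcal F^Q_{\mathsf{PZS}}$, and (privacy) there is a probabilistic polynomial-time (PPT) simulator that for every proper subset $C\subsetneq S$, given $1^\kappa$, $C$, the inputs of $C$ and the shares that $\mathcal F^Q_{\mathsf{PZS}}$ gives to $C$, outputs a datum computationally indistinguishable from the shares and hints that $C$ receives. The secret need not be independent of these data. **Protocol.** Let $Q$ be a formula built with $\land$ and $\lor$ from literals $Q_1,\dots,Q_q$ ($q\ge 1$, one for each occurrence), each a predicate of the inputs of a nonempty set of parties, and let $|\mathsf{OR}|$ be the number of its $\lor$ operators. The protocol $\Pi^Q_{\mathsf{PZS}}$ runs as follows. 1. For each $i$ the parties involved in $Q_i$ call a relaxed predicative zero-sharing $\mathcal F^{Q_i}_{\mathsf{rPZS}}$; the other parties set their shares to $0$. 2. The parties evaluate $Q$ along the formula: for $\land$ they add the two sharings locally; for $\lor$ they multiply them with a fresh Beaver triple $([a],[b],[c])$, where $[a],[b]$ are uniform and $[c]$ is a uniform sharing of $ab$. From $[r],[r']$ they open $d=r-a$ and $e=r'-b$, and take shares of $c+db+ea+de$. Let $[r]$ be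 the final sharing. 3. With one more Beaver triple they open $u=r+a$ and output the shares of $[s]=u[b]-[c]$, a sharing of $r\cdot b$. To open a value, all parties send their shares to $P_1$, who sends the sum to all other parties. Beaver triples come from a trusted offline phase. **Theorem.** Let $\sigma=\sigma(\kappa)$ be such that $2^{-\sigma(\kappa)}$ is negligible, and let $|\mathbb F_\kappa|\ge 2^{\sigma(\kappa)}$ and $|\mathbb F_\kappa|\ge|\mathsf{OR}|\cdot 2^{\sigma(\kappa)}$ for all $\kappa$. Then $\Pi^Q_{\mathsf{PZS}}$ securely realizes $\mathcal F^Q_{\mathsf{PZS}}$ against semi-honest adversaries corrupting any $t<m$ parties in the $(\mathcal F^{Q_1}_{\mathsf{rPZS}},\dots,\mathcal F^{Q_q}_{\mathsf{rPZS}})$-hybrid model: there is a PPT simulator $\mathsf{Sim}$ such that for every proper subset $\mathcal A$ of the parties $$\{\mathsf{Sim}(1^\kappa,\mathcal A,\mathbf x_{\mathcal A},\mathbf s_{\mathcal A}),\,\mathbf s\}_{\mathbf x}\ \overset{c}{\approx}\ \{\mathsf{View}^{\Pi}_{\mathcal A}(\mathbf x),\,\mathsf{Output}^{\Pi}(\mathbf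 x)\}_{\mathbf x},\qquad \mathbf s\gets\mathcal F^Q_{\mathsf{PZS}}(\mathbf x),$$ where the view of a party consists of its input and everything it samples or receives. (Running times of simulators are polynomial in $\kappa$ and the length of the inputs they are given.) Moreover the protocol is correct in the following quantitative sense. For every $\kappa$ and $\mathbf x$, let $\varepsilon_i$ be the total variation distance between the share vector of the $i$-th call in step 1 and the output of $\mathcal F^{Q_i}_{\mathsf{PZS}}$. Let $f(\mathbf x)$ be $0$ if $Q(\mathbf x)=1$ and uniform in $\mathbb F$ otherwise. Then the secret $r$ at the end of step 2 and the output of the protocol satisfy $$\Delta\bigl(r,\,f(\mathbf x)\bigr)\le\sum_{i=1}^q\varepsilon_i+2^{-\sigma},\qquad \Delta\bigl(\mathsf{Output}^{\Pi}(\mathbf x),\,\mathcal F^Q_{\mathsf{PZS}}(\mathbf x)\bigr)\le\sum_{i=1}^q\varepsilon_i+2\cdot2^{-\sigma}.$$ -/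

import Mathlib

namespace PZS

/-! ### Data, programs and running time -/

/-- Data handled by programs at a fixed value of the security parameter: binary trees whose leaves
are empty or carry an element of the field `F`. -/
inductive Val (F : Type) : Type
  | nil : Val F
  | elt (x : F) : Val F
  | pair (a b : Val F) : Val F

namespace Val

variable {F : Type}

/-- The Boolean `true`; the Boolean `false` is `nil`. -/
def tt : Val F := pair nil nil

def ofBool : Bool → Val F
  | false => nil
  | true => tt

def ofList : List (Val F) → Val F
  | [] => nil
  | a :: l => pair a (ofList l)

def ofBits (l : List Bool) : Val F := ofList (l.map ofBool)

def ofOption : Option (Val F) → Val F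
  | none => nil
  | some a => pair a nil

/-- The string `1ⁿ`. -/
def unary (n : ℕ) : Val F := ofList (List.replicate n nil)

/-- The length of a list; trees that are not built by `ofList` are read as lists along their right
spine. -/
def len : Val F → ℕ
  | pair _ b => len b + 1
  | _ => 0

def head : Val F → Val F
  | pair a _ => a
  | _ => nil

def tail : Val F → Val F
  | pair _ b => b
  | _ => nil

/-- A field operation on two elements (`nil` on data of another shape). -/
def binop (f : F → F → F) : Val F → Val F
  | pair (elt x) (elt y) => elt (f x y)
  | _ => nil

def unop (f : F → F) : Val F → Val F
  | elt x => elt (f x)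
  | _ => nil

/-- The binary representation of a field element. -/
def toBits (enc : F ↪ List Bool) : Val F → Val F
  | elt x => ofBits (enc x)
  | _ => nil

open Classical in
/-- The field element with a given binary representation (`nil` if there is none). -/
noncomputable def fromBits (enc : F ↪ List Bool) (v : Val F) : Val F :=
  if h : ∃ x, ofBits (enc x) = v then elt h.choose else nil

end Val

/-- Probabilistic programs. A program maps a datum to a random datum and takes a number of steps. It
does not depend on the security parameter nor on the field. -/
inductive Prog : Type
  | skip : Prog
  | nil : Prog
  | head : Prog
  | tail : Prog
  | pair (p q : Prog) : Prog
  /-- first `p`, then `q` -/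
  | seq (p q : Prog) : Prog
  /-- on `(c, w)`: run `q` on `w` if `c = nil`, and `p` on `w` otherwise -/
  | cond (p q : Prog) : Prog
  /-- on `(n, w)`: apply `p` to `w`, as many times as the list `n` is long -/
  | loop (p : Prog) : Prog
  /-- a uniformly random bit -/
  | coin : Prog
  /-- a uniformly random field element -/
  | unif : Prog
  | one : Prog
  | add : Prog
  | mul : Prog
  | neg : Prog
  | inv : Prog
  | toBits : Prog
  | fromBits : Prog

section Semantics

variable {F : Type} [Field F] [Fintype F]

/-- Iterate a randomized step that reports its cost. -/
noncomputable def iterate (f : Val F → PMF (Val F × ℕ)) : ℕ → Val F → PMF (Val F × ℕ)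
  | 0, v => PMF.pure (v, 1)
  | n + 1, v => (f v).bind fun r => (iterate f n r.1).map fun r' => (r'.1, r.2 + r'.2 + 1)

/-- The joint law of the result and of the number of steps of a program. Elementary operations,
among them arithmetic and uniform sampling in `F`, take one step; conversions between field elements
and bit strings take as many steps as the string is long, plus one. -/
noncomputable def Prog.exec (enc : F ↪ List Bool) : Prog → Val F → PMF (Val F × ℕ)
  | .skip, v => PMF.pure (v, 1)
  | .nil, _ => PMF.pure (Val.nil, 1)
  | .head, v => PMF.pure (v.head, 1)
  | .tail, v => PMF.pure (v.tail, 1)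
  | .pair p q, v =>
      (p.exec enc v).bind fun r =>
        (q.exec enc v).map fun r' => (Val.pair r.1 r'.1, r.2 + r'.2 + 1)
  | .seq p q, v =>
      (p.exec enc v).bind fun r => (q.exec enc r.1).map fun r' => (r'.1, r.2 + r'.2 + 1)
  | .cond p q, v =>
      match v with
      | .pair .nil w => (q.exec enc w).map fun r => (r.1, r.2 + 1)
      | .pair _ w => (p.exec enc w).map fun r => (r.1, r.2 + 1)
      | _ => PMF.pure (Val.nil, 1)
  | .loop p, v => iterate (fun w => p.exec enc w) v.head.len v.tail
  | .coin, _ => (PMF.uniformOfFintype Bool).map fun b => (Val.ofBool b, 1)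
  | .unif, _ => (PMF.uniformOfFintype F).map fun x => (Val.elt x, 1)
  | .one, _ => PMF.pure (Val.elt 1, 1)
  | .add, v => PMF.pure (v.binop (· + ·), 1)
  | .mul, v => PMF.pure (v.binop (· * ·), 1)
  | .neg, v => PMF.pure (v.unop (- ·), 1)
  | .inv, v => PMF.pure (v.unop (·⁻¹), 1)
  | .toBits, v => PMF.pure (v.toBits enc, (v.toBits enc).len + 1)
  | .fromBits, v => PMF.pure (v.fromBits enc, v.len + 1)

/-- The law of the result of a program. -/
noncomputable def Prog.run (enc : F ↪ List Bool) (p : Prog) (v : Val F) : PMF (Val F) :=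
  (p.exec enc v).map Prod.fst

/-- On input `v`, the program `p` always halts within `T` steps. -/
def Prog.CostLE (enc : F ↪ List Bool) (p : Prog) (v : Val F) (T : ℕ) : Prop :=
  ∀ r ∈ (p.exec enc v).support, r.2 ≤ T

/-- The probability that a program answers `true`. -/
noncomputable def Prog.accept (enc : F ↪ List Bool) (p : Prog) (X : PMF (Val F)) : ℝ :=
  ((X.bind (p.run enc)) Val.tt).toReal

end Semantics

/-! ### Indistinguishability -/

/-- `μ` vanishes faster than every inverse polynomial. -/
def Negligible (μ : ℕ → ℝ) : Prop :=
  Asymptotics.SuperpolynomialDecay Filter.atTop (fun n : ℕ => (n : ℝ)) μ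

/-- Private inputs are bit strings. -/
abbrev Input : Type := List Bool

/-- The total length of the inputs of a set of parties. -/
def inputSize {P : Type} (C : Finset P) (x : P → Input) : ℕ := ∑ i ∈ C, (x i).length

/-- The statistical (total variation) distance. -/
noncomputable def tvDist {α : Type} [Fintype α] (p q : PMF α) : ℝ :=
  (∑ a, |(p a).toReal - (q a).toReal|) / 2

section Ensembles

variable {P : Type} [Fintype P] {F : ℕ → Type} [∀ κ, Field (F κ)] [∀ κ, Fintype (F κ)]

/-- Statistical indistinguishability of two ensembles that are indexed by the security parameter and
by the parties' inputs (of polynomial length). -/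
def StatIndist {α : ℕ → Type} [∀ κ, Fintype (α κ)]
    (X Y : (κ : ℕ) → (P → Input) → PMF (α κ)) : Prop :=
  ∀ L : Polynomial ℕ, ∃ μ : ℕ → ℝ, Negligible μ ∧
    ∀ κ x, inputSize Finset.univ x ≤ L.eval κ → tvDist (X κ x) (Y κ x) ≤ μ κ

/-- Computational indistinguishability against probabilistic distinguishers `D` with an arbitrary
advice `z`, which get `(1^κ, z, sample)` and halt within polynomially many steps. -/
def CompIndist (enc : ∀ κ, F κ ↪ List Bool)
    (X Y : (κ : ℕ) → (P → Input) → PMF (Val (F κ))) : Prop :=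
  ∀ (D : Prog) (T L : Polynomial ℕ), ∃ μ : ℕ → ℝ, Negligible μ ∧
    ∀ κ x, inputSize Finset.univ x ≤ L.eval κ → ∀ z : Val (F κ),
      (∀ v, D.CostLE (enc κ) (.pair (.unary κ) (.pair z v)) (T.eval κ)) →
      |D.accept (enc κ) ((X κ x).map fun v => .pair (.unary κ) (.pair z v)) -
        D.accept (enc κ) ((Y κ x).map fun v => .pair (.unary κ) (.pair z v))| ≤ μ κ

end Ensembles

/-! ### Predicative zero-sharing -/

section Functionality

variable {P : Type} [Fintype P] {F : Type} [Field F] [Fintype F]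

open Classical in
theorem sharings_nonempty [Nonempty P] (v : F) :
    (Finset.univ.filter fun s : P → F => ∑ i, s i = v).Nonempty := by
  obtain ⟨j⟩ := ‹Nonempty P›
  exact ⟨Pi.single j v, by simp⟩

open Classical in
/-- A uniformly random additive sharing of `v` among the parties `P`. -/
noncomputable def uniformSharing [Nonempty P] (v : F) : PMF (P → F) :=
  PMF.uniformOfFinset (Finset.univ.filter fun s : P → F => ∑ i, s i = v) (sharings_nonempty v)

open Classical in
/-- The ideal functionality for predicative zero-sharing: uniformly random shares, subject to having
sum zero if the predicate (of the inputs) holds. -/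
noncomputable def idealPZS [Nonempty P] (Q : Prop) : PMF (P → F) :=
  if Q then uniformSharing 0 else PMF.uniformOfFintype (P → F)

open Classical in
/-- The law of the secret that an ideal predicative zero-sharing distributes. -/
noncomputable def idealSecret (Q : Prop) : PMF F :=
  if Q then PMF.pure 0 else PMF.uniformOfFintype F

end Functionality

/-- The data of the parties in `C`, listed in the order of the parties. The entries of the other
parties are left blank. -/
def restrictTo {P F : Type} [Fintype P] [LinearOrder P] (C : Finset P) (w : P → Val F) : Val F :=
  Val.ofList <| ((Finset.univ : Finset P).sort (· ≤ ·)).map fun i =>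
    Val.ofOption (if i ∈ C then some (w i) else none)

/-- The list of all shares. -/
def sharesVal {P F : Type} [Fintype P] [LinearOrder P] (s : P → F) : Val F :=
  restrictTo Finset.univ fun i => Val.elt (s i)

section Security

variable {P : Type} [Fintype P] [LinearOrder P] {F : ℕ → Type}
  [∀ κ, Field (F κ)] [∀ κ, Fintype (F κ)]

/-- The input `(1^κ, C, x_C, s_C)` of a simulator: the security parameter, the set of corrupted
parties, their inputs and their shares. -/
def simInput (κ : ℕ) (C : Finset P) (x : P → Input) (s : P → F κ) : Val (F κ) :=
  .pair (.unary κ) (restrictTo C fun i => .pair (.ofBits (x i)) (.elt (s i)))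

/-- The simulator runs in probabilistic polynomial time. -/
def PolyTimeSim (enc : ∀ κ, F κ ↪ List Bool) (Sim : Prog) : Prop :=
  ∃ T : Polynomial ℕ, ∀ κ (C : Finset P) (x : P → Input) (s : P → F κ),
    Sim.CostLE (enc κ) (simInput κ C x s) (T.eval (κ + inputSize C x))

/-- `G`, which gives each party a share and an additional piece of information (a hint), is a
probabilistic polynomial-time functionality. -/
def PolyTimeFunctionality (enc : ∀ κ, F κ ↪ List Bool)
    (G : (κ : ℕ) → (P → Input) → PMF (P → F κ × Val (F κ))) : Prop :=
  ∃ (g : Prog) (T : Polynomial ℕ), ∀ κ (x : P → Input),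
    g.CostLE (enc κ) (.pair (.unary κ) (restrictTo Finset.univ fun i => .ofBits (x i)))
        (T.eval (κ + inputSize Finset.univ x)) ∧
      g.run (enc κ) (.pair (.unary κ) (restrictTo Finset.univ fun i => .ofBits (x i))) =
        (G κ x).map fun o => restrictTo Finset.univ fun i => .pair (.elt (o i).1) (o i).2

/-- `G` is a relaxed predicative zero-sharing for the predicate `Q` among the parties `P`. It is
correct: the shares are statistically indistinguishable from those of the ideal functionality. It is
private: from the inputs and the ideal shares of a proper subset of the parties, a simulator produces
what this subset receives (shares and hints), up to computational indistinguishability. The secret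
need not be independent of what the subset receives. -/
structure IsRelaxedPZS [Nonempty P] (enc : ∀ κ, F κ ↪ List Bool) (Q : (P → Input) → Prop)
    (G : (κ : ℕ) → (P → Input) → PMF (P → F κ × Val (F κ))) : Prop where
  polyTime : PolyTimeFunctionality enc G
  correct : StatIndist (fun κ x => (G κ x).map fun o i => (o i).1)
    (fun κ x => (idealPZS (Q x) : PMF (P → F κ)))
  priv : ∃ Sim : Prog, PolyTimeSim (P := P) enc Sim ∧
    ∀ C : Finset P, C ≠ Finset.univ →
      CompIndist enc
        (fun κ x => (idealPZS (Q x) : PMF (P → F κ)).bind fun s =>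
          Sim.run (enc κ) (simInput κ C x s))
        (fun κ x => (G κ x).map fun o => restrictTo C fun i => .pair (.elt (o i).1) (o i).2)

/-- The protocol `Π`, which yields the views and the outputs of all parties, securely realizes
predicative zero-sharing for `Q` against every semi-honest adversary that corrupts a proper subset of
the parties: one simulator serves all corrupted sets, and the simulated view together with the ideal
outputs of all parties is computationally indistinguishable from the real view of the corrupted
parties together with the real outputs of all parties. -/
def SecurelyRealizesPZS [Nonempty P] (enc : ∀ κ, F κ ↪ List Bool) (Q : (P → Input) → Prop)
    (prot : (κ : ℕ) → (P → Input) → PMF ((P → List (Val (F κ))) × (P → F κ))) : Prop :=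
  ∃ Sim : Prog, PolyTimeSim (P := P) enc Sim ∧
    ∀ C : Finset P, C ≠ Finset.univ →
      CompIndist enc
        (fun κ x => (idealPZS (Q x) : PMF (P → F κ)).bind fun s =>
          (Sim.run (enc κ) (simInput κ C x s)).map fun w => .pair w (sharesVal s))
        (fun κ x => (prot κ x).map fun o =>
          .pair (restrictTo C fun i => .ofList (o.1 i)) (sharesVal o.2))

end Security

/-! ### Compound predicates -/

/-- Formulas over the connectives `∧` and `∨`. -/
inductive Formula (α : Type 1) : Type 1
  | lit (a : α) : Formula α
  | and (φ ψ : Formula α) : Formula α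
  | or (φ ψ : Formula α) : Formula α

namespace Formula

variable {α : Type 1}

/-- The literals `Q₁, …, Q_q` of a formula, one for each occurrence. -/
def literals : Formula α → List α
  | lit a => [a]
  | and φ ψ => φ.literals ++ ψ.literals
  | or φ ψ => φ.literals ++ ψ.literals

/-- The number of `∨` operators. -/
def numOr : Formula α → ℕ
  | lit _ => 0
  | and φ ψ => φ.numOr + ψ.numOr
  | or φ ψ => φ.numOr + ψ.numOr + 1

/-- The truth value, given those of the literals. -/
def Holds (t : α → Prop) : Formula α → Prop
  | lit a => t a
  | and φ ψ => φ.Holds t ∧ ψ.Holds t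
  | or φ ψ => φ.Holds t ∨ ψ.Holds t

end Formula

/-- A literal: the parties that it involves, a predicate on their inputs (a simple predicate or its
negation), and the functionality that the involved parties call for it, which gives each of them a
share and a hint. -/
structure Literal (F : ℕ → Type) (m : ℕ) : Type 1 where
  parties : Finset (Fin m)
  nonempty : parties.Nonempty
  pred : (parties → Input) → Prop
  func : (κ : ℕ) → (parties → Input) → PMF (parties → F κ × Val (F κ))

instance {F : ℕ → Type} {m : ℕ} (ℓ : Literal F m) : Nonempty ℓ.parties := ℓ.nonempty.to_subtype

/-- The compound predicate on the inputs of all parties that a formula defines. -/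
def Formula.pred {F : ℕ → Type} {m : ℕ} (φ : Formula (Literal F m)) (x : Fin m → Input) : Prop :=
  φ.Holds fun ℓ => ℓ.pred fun i => x i

/-- The statistical distance between the shares that the functionality of a literal gives out and
ideal shares. -/
noncomputable def Literal.error {F : ℕ → Type} [∀ κ, Field (F κ)] [∀ κ, Fintype (F κ)] {m : ℕ}
    (ℓ : Literal F m) (κ : ℕ) (x : Fin m → Input) : ℝ :=
  tvDist ((ℓ.func κ fun i => x i).map fun o i => (o i).1) (idealPZS (ℓ.pred fun i => x i))

/-! ### The protocol -/

section Protocol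

variable {m : ℕ} [NeZero m] {F : Type} [Field F] [Fintype F]

/-- The messages that the parties receive when an additively shared value is opened: all other
parties send their shares to the leader (party `0`), who sends the sum to all other parties. -/
def opening (w : Fin m → F) (i : Fin m) : List (Val F) :=
  if i = 0 then ((List.finRange m).filter (· ≠ 0)).map fun j => Val.elt (w j)
  else [Val.elt (∑ j, w j)]

/-- A Beaver triple `([a], [b], [c])` from the offline phase: `[a]` and `[b]` are uniformly random
sharings and `[c]` is a uniformly random sharing of `a * b`. -/
noncomputable def beaverTriple : PMF ((Fin m → F) × (Fin m → F) × (Fin m → F)) := do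
  let a ← PMF.uniformOfFintype (Fin m → F)
  let b ← PMF.uniformOfFintype (Fin m → F)
  let c ← uniformSharing ((∑ i, a i) * ∑ i, b i)
  return (a, b, c)

/-- Secure multiplication `[r] * [r']` with a fresh Beaver triple: open `d = r - a` and
`e = r' - b`, and output shares of `c + d * b + e * a + d * e`. Returns the shares and what each party
receives. -/
noncomputable def secureMul (r r' : Fin m → F) :
    PMF ((Fin m → F) × (Fin m → List (Val F))) := do
  let (a, b, c) ← beaverTriple
  let d := ∑ i, (r i - a i)
  let e := ∑ i, (r' i - b i)
  return (fun i => c i + d * b i + e * a i + (if i = 0 then d * e else 0),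
    fun i => [.elt (a i), .elt (b i), .elt (c i)] ++
      opening (fun j => r j - a j) i ++ opening (fun j => r' j - b j) i)

/-- The transformation `[s] = [r] * [b]` from relaxed to standard, where the random multiplier `[b]`
is that of a Beaver triple: open `u = r + a`, and output shares of `u * b - c`. -/
noncomputable def transformation (r : Fin m → F) :
    PMF ((Fin m → F) × (Fin m → List (Val F))) := do
  let (a, b, c) ← beaverTriple
  let u := ∑ i, (r i + a i)
  return (fun i => u * b i - c i,
    fun i => [.elt (a i), .elt (b i), .elt (c i)] ++ opening (fun j => r j + a j) i)

end Protocol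

section Protocol

variable {m : ℕ} [NeZero m] {F : ℕ → Type} [∀ κ, Field (F κ)] [∀ κ, Fintype (F κ)]

/-- The sharing stage and the formula emulation stage: every literal is shared by one fresh call of
its functionality (uninvolved parties set their shares to `0`), `∧` adds shares locally and `∨`
multiplies them securely. Returns the shares of the parties and what they receive, listed along the
formula. -/
noncomputable def emulation (κ : ℕ) (x : Fin m → Input) :
    Formula (Literal F m) → PMF ((Fin m → F κ) × (Fin m → List (Val (F κ))))
  | .lit ℓ => do
      let o ← ℓ.func κ fun i => x i
      return (fun i => if h : i ∈ ℓ.parties then (o ⟨i, h⟩).1 else 0,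
        fun i => if h : i ∈ ℓ.parties then [.elt (o ⟨i, h⟩).1, (o ⟨i, h⟩).2] else [])
  | .and φ ψ => do
      let (r, v) ← emulation κ x φ
      let (r', v') ← emulation κ x ψ
      return (fun i => r i + r' i, fun i => v i ++ v' i)
  | .or φ ψ => do
      let (r, v) ← emulation κ x φ
      let (r', v') ← emulation κ x ψ
      let (t, w) ← secureMul r r'
      return (t, fun i => v i ++ v' i ++ w i)

/-- The compound predicative zero-sharing protocol. The view of a party consists of its input and of
everything that it received or sampled. -/
noncomputable def protocol (φ : Formula (Literal F m)) (κ : ℕ) (x : Fin m → Input) :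
    PMF ((Fin m → List (Val (F κ))) × (Fin m → F κ)) := do
  let (r, v) ← emulation κ x φ
  let (s, w) ← transformation r
  return (fun i => Val.ofBits (x i) :: (v i ++ w i), s)

end Protocol

end PZS

/-! Every coalition `C` other than the set of all parties misses some party, whose share of a value
acts as a one-time pad on the shares of `C`. The triple masks the opened values, so these look
uniform and independent of the secrets: all that `C` sees of the protocol can be sampled, with its
exact distribution, from the outputs of the calls and from shares of the final output.

The secret after the evaluation is close to the ideal one because sums and products of ideal secrets
are again ideal, apart from an error `1 / |F|` for each product, which vanishes with that
probability even if both factors are uniform. The last multiplication by a uniform `b` maps `0` to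
`0` and any other secret to a uniform one, so the output consists of ideal shares for the predicate
`r = 0`, and these are ideal shares for `Q` unless the secret is wrong.

A simulator replaces the calls one at a time by their own simulators, which are run on uniform
shares: a coalition that misses a party of the call sees uniform shares whatever the predicate. A
call all of whose parties belong to `C` is run by the simulator itself. -/

namespace PZS

/-! ### Laws of random variables and their distance -/

section Probability

variable {α β : Type*}

theorem summable_toReal (X : PMF α) : Summable fun a => (X a).toReal :=
  ENNReal.summable_toReal X.tsum_coe_ne_top

theorem tsum_toReal (X : PMF α) : ∑' a, (X a).toReal = 1 := by
  rw [← ENNReal.tsum_toReal_eq X.apply_ne_top, X.tsum_coe, ENNReal.toReal_one]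

theorem toReal_apply_le_one (X : PMF α) (a : α) : (X a).toReal ≤ 1 := by
  simpa using ENNReal.toReal_mono ENNReal.one_ne_top (X.coe_le_one a)

theorem toReal_bind_apply (X : PMF α) (f : α → PMF β) (b : β) :
    (X.bind f b).toReal = ∑' a, (X a).toReal * (f a b).toReal := by
  rw [PMF.bind_apply, ENNReal.tsum_toReal_eq fun a =>
    ENNReal.mul_ne_top (X.apply_ne_top a) ((f a).apply_ne_top b)]
  simp only [ENNReal.toReal_mul]

theorem toReal_toOuterMeasure (X : PMF α) (B : Set α) :
    (X.toOuterMeasure B).toReal = ∑' a, (X a).toReal * B.indicator 1 a := by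
  rw [PMF.toOuterMeasure_apply, ENNReal.tsum_toReal_eq fun a =>
    ((Set.indicator_le_self B X a).trans_lt (X.apply_lt_top a)).ne]
  refine tsum_congr fun a => ?_
  by_cases h : a ∈ B <;> simp [h]

theorem summable_toReal_mul (X : PMF α) {h : α → ℝ} {c : ℝ} (hc : ∀ a, |h a| ≤ c) :
    Summable fun a => (X a).toReal * h a := by
  refine Summable.of_norm_bounded ((summable_toReal X).mul_right c) fun a => ?_
  rw [Real.norm_eq_abs, abs_mul, abs_of_nonneg ENNReal.toReal_nonneg]
  exact mul_le_mul_of_nonneg_left (hc a) ENNReal.toReal_nonneg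

theorem abs_toReal_sub_toReal_le_one (p q : PMF α) (a : α) :
    |(p a).toReal - (q a).toReal| ≤ 1 :=
  abs_sub_le_of_nonneg_of_le ENNReal.toReal_nonneg (toReal_apply_le_one p a)
    ENNReal.toReal_nonneg (toReal_apply_le_one q a)

theorem abs_bind_sub_bind_le_tsum (X : PMF α) {f g : α → PMF β} {b : β} {h : α → ℝ} {c : ℝ}
    (hc : ∀ a, |h a| ≤ c) (hfg : ∀ a, |(f a b).toReal - (g a b).toReal| ≤ h a) :
    |(X.bind f b).toReal - (X.bind g b).toReal| ≤ ∑' a, (X a).toReal * h a := by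
  have summable_bind (f : α → PMF β) : Summable fun a => (X a).toReal * (f a b).toReal :=
    summable_toReal_mul X fun _ =>
      (abs_of_nonneg ENNReal.toReal_nonneg).trans_le (toReal_apply_le_one _ _)
  rw [toReal_bind_apply, toReal_bind_apply, ← (summable_bind f).tsum_sub (summable_bind g),
    ← Real.norm_eq_abs]
  refine tsum_of_norm_bounded (summable_toReal_mul X hc).hasSum fun a => ?_
  rw [Real.norm_eq_abs, ← mul_sub, abs_mul, abs_of_nonneg ENNReal.toReal_nonneg]
  exact mul_le_mul_of_nonneg_left (hfg a) ENNReal.toReal_nonneg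

theorem abs_bind_sub_bind_le (X : PMF α) {f g : α → PMF β} {b : β} {μ : ℝ}
    (h : ∀ a, |(f a b).toReal - (g a b).toReal| ≤ μ) :
    |(X.bind f b).toReal - (X.bind g b).toReal| ≤ μ := by
  simpa only [tsum_mul_right, tsum_toReal, one_mul] using
    abs_bind_sub_bind_le_tsum X (fun _ => le_rfl) h

theorem abs_bind_sub_bind_le_toOuterMeasure (X : PMF α) {f g : α → PMF β} {B : Set α}
    (h : ∀ a ∉ B, f a = g a) (b : β) :
    |(X.bind f b).toReal - (X.bind g b).toReal| ≤ (X.toOuterMeasure B).toReal := by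
  rw [toReal_toOuterMeasure]
  refine abs_bind_sub_bind_le_tsum X (c := 1) (fun a => ?_) fun a => ?_
  · by_cases ha : a ∈ B <;> simp [ha]
  · by_cases ha : a ∈ B
    · simpa [ha] using abs_toReal_sub_toReal_le_one (f a) (g a) b
    · simp [ha, h a ha]

theorem bind_congr_of_support (X : PMF α) {f g : α → PMF β} (h : ∀ a ∈ X.support, f a = g a) :
    X.bind f = X.bind g := by
  ext b
  simp only [PMF.bind_apply]
  refine tsum_congr fun a => ?_
  by_cases ha : a ∈ X.support
  · rw [h a ha]
  · rw [(X.apply_eq_zero_iff a).2 ha, zero_mul, zero_mul]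

/-- The joint law of two independent random variables. -/
noncomputable def prodLaw (p : PMF α) (q : PMF β) : PMF (α × β) :=
  p.bind fun a => q.map (Prod.mk a)

theorem prodLaw_bind {γ : Type*} (p : PMF α) (q : PMF β) (f : α × β → PMF γ) :
    (prodLaw p q).bind f = p.bind fun a => q.bind fun b => f (a, b) := by
  simp only [prodLaw, PMF.bind_bind, PMF.bind_map]
  rfl

theorem prodLaw_map {γ : Type*} (p : PMF α) (q : PMF β) (f : α × β → γ) :
    (prodLaw p q).map f = p.bind fun a => q.map fun b => f (a, b) := by
  simp only [prodLaw, PMF.map_bind, PMF.map_comp]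
  rfl

theorem mem_support_prodLaw_iff {p : PMF α} {q : PMF β} {r : α × β} :
    r ∈ (prodLaw p q).support ↔ r.1 ∈ p.support ∧ r.2 ∈ q.support := by
  obtain ⟨a, b⟩ := r
  simp [prodLaw, and_comm]

end Probability

section TvDist

variable {α β : Type} [Fintype α] [Fintype β]

theorem sum_toReal (p : PMF α) : ∑ a, (p a).toReal = 1 := by
  rw [← tsum_toReal p, tsum_fintype]

theorem tvDist_self (p : PMF α) : tvDist p p = 0 := by
  simp [tvDist]

theorem tvDist_nonneg (p q : PMF α) : 0 ≤ tvDist p q :=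
  div_nonneg (Finset.sum_nonneg fun _ _ => abs_nonneg _) zero_le_two

theorem tvDist_triangle (p q r : PMF α) : tvDist p r ≤ tvDist p q + tvDist q r := by
  unfold tvDist
  rw [← add_div, ← Finset.sum_add_distrib]
  gcongr
  exact abs_sub_le _ _ _

theorem tvDist_le_one (p q : PMF α) : tvDist p q ≤ 1 := by
  have h : ∑ a, |(p a).toReal - (q a).toReal| ≤ 1 + 1 := calc
    _ ≤ ∑ a, ((p a).toReal + (q a).toReal) := Finset.sum_le_sum fun a _ => by
        simpa only [abs_of_nonneg ENNReal.toReal_nonneg] using abs_sub (p a).toReal (q a).toReal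
    _ = 1 + 1 := by rw [Finset.sum_add_distrib, sum_toReal, sum_toReal]
  unfold tvDist
  linarith

theorem tvDist_bind_le (p q : PMF α) (k : α → PMF β) :
    tvDist (p.bind k) (q.bind k) ≤ tvDist p q := by
  unfold tvDist
  refine div_le_div_of_nonneg_right ?_ zero_le_two
  calc ∑ b, |(p.bind k b).toReal - (q.bind k b).toReal|
      ≤ ∑ b, ∑ a, |(p a).toReal - (q a).toReal| * (k a b).toReal := by
        refine Finset.sum_le_sum fun b _ => ?_
        simp only [toReal_bind_apply, tsum_fintype]
        rw [← Finset.sum_sub_distrib]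
        refine (Finset.abs_sum_le_sum_abs _ _).trans_eq (Finset.sum_congr rfl fun a _ => ?_)
        rw [← sub_mul, abs_mul, abs_of_nonneg (ENNReal.toReal_nonneg (a := k a b))]
    _ = ∑ a, |(p a).toReal - (q a).toReal| := by
        rw [Finset.sum_comm]
        exact Finset.sum_congr rfl fun a _ => by rw [← Finset.mul_sum, sum_toReal, mul_one]

theorem tvDist_map_le (p q : PMF α) (f : α → β) : tvDist (p.map f) (q.map f) ≤ tvDist p q :=
  tvDist_bind_le p q _

section Mixture

variable {ι : Type*}

theorem tvDist_bind_bind_le_tsum (p : PMF ι) (k k' : ι → PMF β) :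
    tvDist (p.bind k) (p.bind k') ≤ ∑' a, (p a).toReal * tvDist (k a) (k' a) := by
  have abs_le_one (b : β) (a : ι) : |(|(k a b).toReal - (k' a b).toReal|)| ≤ 1 :=
    (abs_abs _).trans_le (abs_toReal_sub_toReal_le_one _ _ _)
  have pointwise (b : β) : |(p.bind k b).toReal - (p.bind k' b).toReal| ≤
      ∑' a, (p a).toReal * |(k a b).toReal - (k' a b).toReal| :=
    abs_bind_sub_bind_le_tsum p (abs_le_one b) fun _ => le_rfl
  simp only [tvDist, ← mul_div_assoc, tsum_div_const, Finset.mul_sum]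
  rw [Summable.tsum_finsetSum fun b _ => summable_toReal_mul p (abs_le_one b)]
  gcongr
  exact pointwise _

theorem tvDist_bind_bind_le (p : PMF ι) {k k' : ι → PMF β} {c : ℝ}
    (h : ∀ a, tvDist (k a) (k' a) ≤ c) : tvDist (p.bind k) (p.bind k') ≤ c := by
  have abs_le_one (a : ι) : |tvDist (k a) (k' a)| ≤ 1 :=
    (abs_of_nonneg (tvDist_nonneg _ _)).trans_le (tvDist_le_one _ _)
  calc
    _ ≤ ∑' a, (p a).toReal * tvDist (k a) (k' a) := tvDist_bind_bind_le_tsum p k k'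
    _ ≤ ∑' a, (p a).toReal * c := Summable.tsum_le_tsum
      (fun a => mul_le_mul_of_nonneg_left (h a) ENNReal.toReal_nonneg)
      (summable_toReal_mul p abs_le_one) ((summable_toReal p).mul_right c)
    _ = c := by rw [tsum_mul_right, tsum_toReal, one_mul]

theorem tvDist_bind_bind_le_apply (p : PMF ι) {k k' : ι → PMF β} (a₀ : ι)
    (h : ∀ a, a ≠ a₀ → k a = k' a) : tvDist (p.bind k) (p.bind k') ≤ (p a₀).toReal := by
  refine (tvDist_bind_bind_le_tsum p k k').trans ?_
  rw [tsum_eq_single a₀ fun a ha => by rw [h a ha, tvDist_self, mul_zero]]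
  exact mul_le_of_le_one_right ENNReal.toReal_nonneg (tvDist_le_one _ _)

end Mixture

theorem tvDist_prodLaw_le (p q : PMF α) (p' q' : PMF β) :
    tvDist (prodLaw p p') (prodLaw q q') ≤ tvDist p q + tvDist p' q' := calc
  _ ≤ tvDist (prodLaw p p') (prodLaw q p') + tvDist (prodLaw q p') (prodLaw q q') :=
    tvDist_triangle _ _ _
  _ ≤ tvDist p q + tvDist p' q' :=
    add_le_add (tvDist_bind_le _ _ _) (tvDist_bind_bind_le _ fun _ => tvDist_map_le _ _ _)

theorem toOuterMeasure_sub_le_tvDist (p q : PMF α) (B : Set α) :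
    (p.toOuterMeasure B).toReal - (q.toOuterMeasure B).toReal ≤ tvDist p q := by
  -- The positive part of `p - q` has total mass `tvDist p q`.
  have pointwise (a : α) : ((p a).toReal - (q a).toReal) * B.indicator 1 a ≤
      |(p a).toReal - (q a).toReal| / 2 + ((p a).toReal - (q a).toReal) / 2 := by
    have := le_abs_self ((p a).toReal - (q a).toReal)
    have := neg_abs_le ((p a).toReal - (q a).toReal)
    by_cases h : a ∈ B <;> simp only [h, Set.indicator_of_mem, Set.indicator_of_notMem,
      not_false_eq_true, Pi.one_apply, mul_one, mul_zero] <;> linarith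
  calc (p.toOuterMeasure B).toReal - (q.toOuterMeasure B).toReal
      = ∑ a, ((p a).toReal - (q a).toReal) * B.indicator 1 a := by
        simp only [toReal_toOuterMeasure, tsum_fintype, sub_mul, Finset.sum_sub_distrib]
    _ ≤ ∑ a, (|(p a).toReal - (q a).toReal| / 2 + ((p a).toReal - (q a).toReal) / 2) :=
        Finset.sum_le_sum fun a _ => pointwise a
    _ = tvDist p q := by
        rw [Finset.sum_add_distrib, ← Finset.sum_div, ← Finset.sum_div, Finset.sum_sub_distrib,
          sum_toReal, sum_toReal, sub_self, zero_div, add_zero, tvDist]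

end TvDist

/-! ### Uniform sharings -/

section Uniform

theorem uniformOfFinset_map_of_bijOn {α β : Type*} {s : Finset α} {t : Finset β}
    (hs : s.Nonempty) (ht : t.Nonempty) {f : α → β} (hf : Set.BijOn f s t) :
    (PMF.uniformOfFinset s hs).map f = PMF.uniformOfFinset t ht := by
  have hcard : s.card = t.card := Finset.card_nbij f hf.mapsTo hf.injOn hf.surjOn
  ext b
  classical
  rw [PMF.map_apply]
  by_cases hb : b ∈ t
  · obtain ⟨a, ha, rfl⟩ := hf.surjOn hb
    rw [tsum_eq_single a, if_pos rfl, PMF.uniformOfFinset_apply_of_mem hs ha,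
      PMF.uniformOfFinset_apply_of_mem ht hb, hcard]
    intro a' ha'
    by_cases h : f a = f a'
    · rw [if_pos h, PMF.uniformOfFinset_apply_of_notMem hs fun h' => ha' (hf.injOn h' ha h.symm)]
    · rw [if_neg h]
  · rw [PMF.uniformOfFinset_apply_of_notMem ht hb, ENNReal.tsum_eq_zero]
    intro a
    by_cases h : b = f a
    · rw [if_pos h, PMF.uniformOfFinset_apply_of_notMem hs fun ha => hb (h ▸ hf.mapsTo ha)]
    · rw [if_neg h]

theorem uniformOfFintype_map_of_bijective {α β : Type*} [Fintype α] [Nonempty α] [Fintype β]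
    [Nonempty β] {f : α → β} (hf : f.Bijective) :
    (PMF.uniformOfFintype α).map f = PMF.uniformOfFintype β :=
  uniformOfFinset_map_of_bijOn _ _ (by simpa using hf)

theorem uniformOfFintype_bind_of_bijective {α β γ : Type*} [Fintype α] [Nonempty α] [Fintype β]
    [Nonempty β] {f : α → β} (hf : f.Bijective) (k : β → PMF γ) :
    ((PMF.uniformOfFintype α).bind fun a => k (f a)) = (PMF.uniformOfFintype β).bind k := by
  rw [← uniformOfFintype_map_of_bijective hf, PMF.bind_map]
  rfl

section IdealSecret

variable {F : Type} [Field F] [Fintype F]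

theorem idealSecret_of_true {Q : Prop} (h : Q) : (idealSecret Q : PMF F) = PMF.pure 0 := if_pos h

theorem idealSecret_of_false {Q : Prop} (h : ¬ Q) :
    (idealSecret Q : PMF F) = PMF.uniformOfFintype F := if_neg h

end IdealSecret

variable {P : Type} [Fintype P]

section Adjust

variable [DecidableEq P] {M : Type*} [AddCommGroup M]

/-- Shift the share of the party `j` so that the shares have sum `v`. -/
def adjust (j : P) (v : M) (s : P → M) : P → M := s + Pi.single j (v - ∑ i, s i)

theorem sum_adjust (j : P) (v : M) (s : P → M) : ∑ i, adjust j v s i = v := by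
  simp [adjust, Finset.sum_add_distrib]

theorem adjust_apply_of_ne {j i : P} (h : i ≠ j) (v : M) (s : P → M) : adjust j v s i = s i := by
  simp [adjust, h]

theorem adjust_bijOn (j : P) (v w : M) :
    Set.BijOn (adjust j v) {s | ∑ i, s i = w} {s | ∑ i, s i = v} := by
  refine Set.InvOn.bijOn (f' := adjust j w) ⟨?_, ?_⟩ (fun s _ => sum_adjust j v s)
    fun s _ => sum_adjust j w s
  all_goals
    rintro s rfl
    simp [adjust, Finset.sum_add_distrib, add_assoc, ← Pi.single_add]

omit [DecidableEq P] in
theorem card_sharings [Nonempty P] [Finite M] (v : M) :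
    Nat.card M * Nat.card {s : P → M // ∑ i, s i = v} = Nat.card (P → M) := by
  classical
  have := Fintype.ofFinite M
  obtain ⟨j⟩ := ‹Nonempty P›
  have card_eq (w : M) :
      Nat.card {s : P → M // ∑ i, s i = w} = Nat.card {s : P → M // ∑ i, s i = v} :=
    Nat.card_congr ((adjust_bijOn j v w).equiv _)
  rw [Nat.card_congr (Equiv.sigmaFiberEquiv fun s : P → M => ∑ i, s i).symm, Nat.card_sigma,
    Finset.sum_congr rfl fun w _ => card_eq w, Finset.sum_const, smul_eq_mul, Finset.card_univ,
    Nat.card_eq_fintype_card]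

end Adjust

variable {F : Type} [Field F] [Fintype F] [Nonempty P]

theorem uniformSharing_map_of_bijOn {v w : F} {f : (P → F) → P → F}
    (hf : Set.BijOn f {s | ∑ i, s i = v} {s | ∑ i, s i = w}) :
    (uniformSharing v).map f = uniformSharing w :=
  uniformOfFinset_map_of_bijOn _ _ (by simpa using hf)

theorem uniformSharing_map_sub_left (y : P → F) (v : F) :
    (uniformSharing v).map (fun s => y - s) = uniformSharing (∑ i, y i - v) := by
  refine uniformSharing_map_of_bijOn (Set.InvOn.bijOn (f' := fun s => y - s) ?_ ?_ ?_)
  · exact ⟨fun s _ => sub_sub_cancel y s, fun s _ => sub_sub_cancel y s⟩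
  · rintro s rfl
    simp
  · intro s (hs : ∑ i, s i = _)
    simp [hs]

theorem uniformSharing_apply_of_sum_eq {v : F} {s : P → F} (h : ∑ i, s i = v) :
    uniformSharing v s = (Nat.card {s : P → F // ∑ i, s i = v} : ENNReal)⁻¹ := by
  classical
  rw [uniformSharing, PMF.uniformOfFinset_apply_of_mem _ (by simpa using h),
    Nat.card_eq_fintype_card, Fintype.card_subtype]

theorem uniformSharing_apply_of_sum_ne {v : F} {s : P → F} (h : ∑ i, s i ≠ v) :
    uniformSharing v s = 0 := by
  rw [uniformSharing, PMF.uniformOfFinset_apply_of_notMem _ (by simpa using h)]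

theorem sum_eq_of_mem_support_uniformSharing {v : F} {s : P → F}
    (hs : s ∈ (uniformSharing v).support) : ∑ i, s i = v := by
  simpa [uniformSharing] using hs

theorem uniformSharing_map_sum (v : F) :
    (uniformSharing v : PMF (P → F)).map (fun s => ∑ i, s i) = PMF.pure v := calc
  _ = (uniformSharing v).bind fun _ => PMF.pure v := bind_congr_of_support _ fun _ hs =>
    congrArg PMF.pure (sum_eq_of_mem_support_uniformSharing hs)
  _ = PMF.pure v := PMF.bind_const _ _

theorem idealPZS_of_true {Q : Prop} (h : Q) :
    (idealPZS Q : PMF (P → F)) = uniformSharing 0 := if_pos h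

variable [DecidableEq P]

theorem uniformOfFintype_bind_uniformSharing :
    (PMF.uniformOfFintype F).bind uniformSharing = PMF.uniformOfFintype (P → F) := by
  ext s
  rw [PMF.bind_apply, tsum_fintype, Finset.sum_eq_single (∑ i, s i)]
  · rw [uniformSharing_apply_of_sum_eq rfl, PMF.uniformOfFintype_apply,
      PMF.uniformOfFintype_apply, ← Nat.card_eq_fintype_card, ← Nat.card_eq_fintype_card,
      ← card_sharings (∑ i, s i), Nat.cast_mul,
      ENNReal.mul_inv (.inr (ENNReal.natCast_ne_top _)) (.inl (ENNReal.natCast_ne_top _))]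
  · intro v _ hv
    rw [uniformSharing_apply_of_sum_ne hv.symm, mul_zero]
  · simp

theorem uniformSharing_eq_map_adjust (j : P) (v : F) :
    (uniformSharing v : PMF (P → F)) = (PMF.uniformOfFintype (P → F)).map (adjust j v) := by
  simp only [← uniformOfFintype_bind_uniformSharing, PMF.map_bind,
    uniformSharing_map_of_bijOn (adjust_bijOn j v _), PMF.bind_const]

theorem idealPZS_of_false {Q : Prop} (h : ¬ Q) :
    (idealPZS Q : PMF (P → F)) = PMF.uniformOfFintype (P → F) := by
  rw [idealPZS, if_neg h]
  congr!

omit [DecidableEq P] in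
theorem idealSecret_bind_uniformSharing (Q : Prop) :
    (idealSecret Q).bind uniformSharing = (idealPZS Q : PMF (P → F)) := by
  classical
  by_cases h : Q
  · rw [idealSecret_of_true h, idealPZS_of_true h, PMF.pure_bind]
  · rw [idealSecret_of_false h, idealPZS_of_false h, uniformOfFintype_bind_uniformSharing]

omit [DecidableEq P] in
theorem idealPZS_map_sum (Q : Prop) :
    (idealPZS Q : PMF (P → F)).map (fun s => ∑ i, s i) = idealSecret Q := by
  classical
  simp only [← idealSecret_bind_uniformSharing, PMF.map_bind, uniformSharing_map_sum,
    PMF.bind_pure]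

omit [DecidableEq P] in
theorem uniformOfFintype_bind_uniformSharing_mul (ρ : F) :
    ((PMF.uniformOfFintype F).bind fun v => uniformSharing (ρ * v)) =
      (idealPZS (ρ = 0) : PMF (P → F)) := by
  classical
  by_cases h : ρ = 0
  · simp only [h, zero_mul, PMF.bind_const, idealPZS_of_true]
  · rw [idealPZS_of_false h, uniformOfFintype_bind_of_bijective (mulLeft_bijective₀ ρ h),
      uniformOfFintype_bind_uniformSharing]

/-- The share of a party outside of `C` serves as a one-time pad for the secret. -/
theorem uniformSharing_bind_of_dependsOn {α : Type*} {C : Finset P} (hC : C ≠ Finset.univ)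
    {k : (P → F) → PMF α} (hk : DependsOn k C) (v : F) :
    (uniformSharing v).bind k = (PMF.uniformOfFintype (P → F)).bind k := by
  classical
  obtain ⟨j, hj⟩ : ∃ j, j ∉ C := by simpa [Finset.eq_univ_iff_forall] using hC
  rw [uniformSharing_eq_map_adjust j, PMF.bind_map]
  exact congrArg _ <| funext fun s => hk fun i hi =>
    adjust_apply_of_ne (ne_of_mem_of_not_mem hi hj) v s

theorem idealPZS_bind_of_dependsOn {α : Type*} {C : Finset P} (hC : C ≠ Finset.univ)
    {k : (P → F) → PMF α} (hk : DependsOn k C) (Q : Prop) :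
    (idealPZS Q).bind k = (PMF.uniformOfFintype (P → F)).bind k := by
  rw [← idealSecret_bind_uniformSharing, PMF.bind_bind]
  simp only [uniformSharing_bind_of_dependsOn hC hk, PMF.bind_const]

/-- The multiplier `b` of the last protocol step acts like an independent uniform secret, because
its sharing is incomplete without the party outside of `C`. -/
theorem uniformOfFintype_bind_uniformSharing_mul_sum {α : Type*} {C : Finset P}
    (hC : C ≠ Finset.univ) (ρ : F) {k : (P → F) → (P → F) → PMF α}
    (hk : ∀ s, DependsOn (k s) C) :
    ((PMF.uniformOfFintype (P → F)).bind fun b =>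
        (uniformSharing (ρ * ∑ i, b i)).bind fun s => k s b) =
      (idealPZS (ρ = 0)).bind fun s => (PMF.uniformOfFintype (P → F)).bind (k s) := by
  calc
    _ = (PMF.uniformOfFintype F).bind fun v => (uniformSharing v).bind fun b =>
          (uniformSharing (ρ * v)).bind fun s => k s b := by
      rw [← uniformOfFintype_bind_uniformSharing, PMF.bind_bind]
      exact congrArg _ <| funext fun v => bind_congr_of_support _ fun b hb => by
        rw [sum_eq_of_mem_support_uniformSharing hb]
    _ = (PMF.uniformOfFintype F).bind fun v => (uniformSharing (ρ * v)).bind fun s =>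
          (PMF.uniformOfFintype (P → F)).bind (k s) := by
      refine congrArg _ <| funext fun v => ?_
      rw [PMF.bind_comm]
      simp only [uniformSharing_bind_of_dependsOn hC (hk _)]
    _ = _ := by rw [← PMF.bind_bind, uniformOfFintype_bind_uniformSharing_mul]

end Uniform

/-! ### What a coalition sees of the protocol -/

section Observation

variable {P F : Type} [DecidableEq P]

/-- The shares of all parties and the lists of messages that they have received. -/
abbrev State (P F : Type) : Type := (P → F) × (P → List (Val F))

/-- The part of a state that a coalition knows; the data of the other parties are blanked out. -/
def restrict [Zero F] (C : Finset P) (p : State P F) : State P F :=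
  (C.piecewise p.1 0, C.piecewise p.2 fun _ => [])

/-- The secret, together with the part of a state that a coalition knows. -/
def observe [Fintype P] [AddCommMonoid F] (C : Finset P) (p : State P F) : F × State P F :=
  (∑ i, p.1 i, restrict C p)

/-- Add the shares and concatenate the messages of two states. -/
def combine [Add F] (p q : State P F) : State P F := (p.1 + q.1, fun i => p.2 i ++ q.2 i)

/-- The shares of the state `p`, and its messages appended to the messages `v` received earlier. -/
def receiveAfter (v : P → List (Val F)) (p : State P F) : State P F := (p.1, fun i => v i ++ p.2 i)

theorem restrict_congr [Zero F] {C : Finset P} {p q : State P F} (h₁ : ∀ i ∈ C, p.1 i = q.1 i)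
    (h₂ : ∀ i ∈ C, p.2 i = q.2 i) : restrict C p = restrict C q :=
  Prod.ext (C.piecewise_congr h₁ fun _ _ => rfl) (C.piecewise_congr h₂ fun _ _ => rfl)

theorem restrict_combine [AddMonoid F] (C : Finset P) (p q : State P F) :
    restrict C (combine p q) = combine (restrict C p) (restrict C q) := by
  refine Prod.ext (funext fun i => ?_) (funext fun i => ?_) <;>
    by_cases hi : i ∈ C <;> simp [restrict, combine, hi]

theorem observe_receiveAfter [Fintype P] [AddCommMonoid F] (C : Finset P) (v : P → List (Val F))
    (p : State P F) : observe C (receiveAfter v p) =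
      ((observe C p).1, receiveAfter (C.piecewise v fun _ => []) (observe C p).2) := by
  refine Prod.ext rfl (Prod.ext rfl (funext fun i => ?_))
  by_cases hi : i ∈ C <;> simp [observe, restrict, receiveAfter, hi]

theorem observe_combine [Fintype P] [AddCommMonoid F] (C : Finset P) (p q : State P F) :
    observe C (combine p q) =
      ((observe C p).1 + (observe C q).1, combine (observe C p).2 (observe C q).2) :=
  Prod.ext Finset.sum_add_distrib (restrict_combine C p q)

end Observation

section Multiplication

variable {m : ℕ} [NeZero m] {F : Type} [Field F]

/-- The outcome of a secure multiplication of `[r]` and `[r']` as a function of the values `w` and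
`w'` that the parties send when they open `r - a` and `r' - b`, and of the shares `c`. -/
def mulState (r r' w w' c : Fin m → F) : State (Fin m) F :=
  (fun i => c i + (∑ j, w j) * (r' i - w' i) + (∑ j, w' j) * (r i - w i) +
      (if i = 0 then (∑ j, w j) * ∑ j, w' j else 0),
    fun i => [.elt (r i - w i), .elt (r' i - w' i), .elt (c i)] ++ opening w i ++ opening w' i)

/-- The messages that the parties receive in the transformation of `[r]` as a function of the values
`w` that they send when they open `r + a`, of the multiplier `b` and of their outputs `s`. -/
def transView (r w b s : Fin m → F) : Fin m → List (Val F) := fun i =>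
  [.elt (w i - r i), .elt (b i), .elt ((∑ j, w j) * b i - s i)] ++ opening w i

theorem sum_mulState (r r' w w' c : Fin m → F) :
    ∑ i, (mulState r r' w w' c).1 i =
      ∑ i, c i - (∑ i, r i - ∑ i, w i) * (∑ i, r' i - ∑ i, w' i) + (∑ i, r i) * ∑ i, r' i := by
  simp only [mulState, Finset.sum_add_distrib, ← Finset.mul_sum, Finset.sum_sub_distrib,
    Finset.sum_ite_eq', Finset.mem_univ, if_true]
  ring

variable {C : Finset (Fin m)}

theorem restrict_mulState_congr {r₁ r₂ r₁' r₂' c₁ c₂ : Fin m → F} (hr : ∀ i ∈ C, r₁ i = r₂ i)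
    (hr' : ∀ i ∈ C, r₁' i = r₂' i) (hc : ∀ i ∈ C, c₁ i = c₂ i) (w w' : Fin m → F) :
    restrict C (mulState r₁ r₁' w w' c₁) = restrict C (mulState r₂ r₂' w w' c₂) :=
  restrict_congr (fun i hi => by simp only [mulState, hr i hi, hr' i hi, hc i hi])
    fun i hi => by simp only [mulState, hr i hi, hr' i hi, hc i hi]

theorem piecewise_transView_congr {r₁ r₂ b₁ b₂ : Fin m → F} (hr : ∀ i ∈ C, r₁ i = r₂ i)
    (hb : ∀ i ∈ C, b₁ i = b₂ i) (w s : Fin m → F) :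
    (C.piecewise (transView r₁ w b₁ s) fun _ => []) =
      C.piecewise (transView r₂ w b₂ s) fun _ => [] :=
  C.piecewise_congr (fun i hi => by simp only [transView, hr i hi, hb i hi]) fun _ _ => rfl

variable [Fintype F]

theorem secureMul_eq (r r' : Fin m → F) :
    secureMul r r' = (PMF.uniformOfFintype (Fin m → F)).bind fun w =>
      (PMF.uniformOfFintype (Fin m → F)).bind fun w' =>
        (uniformSharing ((∑ i, r i - ∑ i, w i) * (∑ i, r' i - ∑ i, w' i))).map
          (mulState r r' w w') := by
  simp only [secureMul, beaverTriple, Bind.bind, Pure.pure, PMF.bind_bind, PMF.pure_bind]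
  rw [← uniformOfFintype_bind_of_bijective (Equiv.subLeft r).bijective]
  refine congrArg _ <| funext fun a => ?_
  rw [← uniformOfFintype_bind_of_bijective (Equiv.subLeft r').bijective]
  refine congrArg _ <| funext fun b => ?_
  simp [mulState, ← PMF.bind_pure_comp, Function.comp_def]

theorem transformation_eq (r : Fin m → F) :
    transformation r = (PMF.uniformOfFintype (Fin m → F)).bind fun w =>
      (PMF.uniformOfFintype (Fin m → F)).bind fun b =>
        (uniformSharing ((∑ i, r i) * ∑ i, b i)).map fun s => (s, transView r w b s) := by
  simp only [transformation, beaverTriple, Bind.bind, Pure.pure, PMF.bind_bind, PMF.pure_bind]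
  rw [← uniformOfFintype_bind_of_bijective (Equiv.subRight r).bijective]
  refine congrArg _ <| funext fun w => congrArg _ <| funext fun b => ?_
  have hb : (∑ i, r i) * ∑ i, b i =
      ∑ i, ((∑ j, w j) • b) i - (∑ i, (w - r) i) * ∑ i, b i := by
    simp only [Pi.smul_apply, Pi.sub_apply, smul_eq_mul, ← Finset.mul_sum,
      Finset.sum_sub_distrib]
    ring
  rw [hb, ← uniformSharing_map_sub_left, PMF.map_comp, ← PMF.bind_pure_comp]
  refine congrArg _ <| funext fun c => ?_
  exact congrArg _ <| Prod.ext (by simp [Pi.sub_def]) <| funext fun i => by simp [transView]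

variable (C)

/-- The simulation of what a coalition learns from a secure multiplication: the opened values and
the coalition's shares of the Beaver triple are uniform and independent of each other. -/
noncomputable def simMul (r r' : Fin m → F) : PMF (State (Fin m) F) :=
  (PMF.uniformOfFintype (Fin m → F)).bind fun w => (PMF.uniformOfFintype (Fin m → F)).bind fun w' =>
    (PMF.uniformOfFintype (Fin m → F)).map fun c => restrict C (mulState r r' w w' c)

/-- The simulation of the messages that a coalition receives in the transformation when the parties
output the shares `s`. -/
noncomputable def simTransformation (r s : Fin m → F) : PMF (Fin m → List (Val F)) :=
  (PMF.uniformOfFintype (Fin m → F)).bind fun w =>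
    (PMF.uniformOfFintype (Fin m → F)).map fun b =>
      C.piecewise (transView r w b s) fun _ => []

theorem simMul_piecewise (r r' : Fin m → F) :
    simMul C (C.piecewise r 0) (C.piecewise r' 0) = simMul C r r' := by
  simp only [simMul, restrict_mulState_congr (fun _ => C.piecewise_eq_of_mem r 0)
    (fun _ => C.piecewise_eq_of_mem r' 0) fun _ _ => rfl]

theorem simTransformation_piecewise (r s : Fin m → F) :
    simTransformation C (C.piecewise r 0) s = simTransformation C r s := by
  simp only [simTransformation, piecewise_transView_congr (fun _ => C.piecewise_eq_of_mem r 0)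
    fun _ _ => rfl]

variable {C}

theorem secureMul_map_observe (hC : C ≠ Finset.univ) (r r' : Fin m → F) :
    (secureMul r r').map (observe C) =
      (simMul C r r').map fun p => ((∑ i, r i) * ∑ i, r' i, p) := by
  simp only [secureMul_eq, simMul, PMF.map_bind, PMF.map_comp]
  refine congrArg _ <| funext fun w => congrArg _ <| funext fun w' => ?_
  refine (bind_congr_of_support (g := fun c => PMF.pure
    ((∑ i, r i) * ∑ i, r' i, restrict C (mulState r r' w w' c))) _ fun c hc => ?_).trans
      (uniformSharing_bind_of_dependsOn hC (fun c₁ c₂ hc => ?_) _)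
  · simp [observe, sum_mulState, sum_eq_of_mem_support_uniformSharing hc]
  · rw [restrict_mulState_congr (fun _ _ => rfl) (fun _ _ => rfl) hc]

theorem transformation_map_piecewise (hC : C ≠ Finset.univ) (r : Fin m → F) :
    (transformation r).map (fun p => (p.1, C.piecewise p.2 fun _ => [])) =
      (idealPZS (∑ i, r i = 0)).bind fun s => (simTransformation C r s).map fun w => (s, w) := by
  have hk (w s : Fin m → F) : DependsOn (fun b => (PMF.pure
      (s, C.piecewise (transView r w b s) fun _ => []) : PMF (State (Fin m) F))) C :=
    fun b₁ b₂ hb => congrArg (fun v => PMF.pure (s, v))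
      (piecewise_transView_congr (fun _ _ => rfl) hb w s)
  simp only [transformation_eq, simTransformation, PMF.map_bind, PMF.map_comp]
  rw [PMF.bind_comm (idealPZS _)]
  exact congrArg _ <| funext fun w => uniformOfFintype_bind_uniformSharing_mul_sum hC _ (hk w)

end Multiplication

/-! ### Simulation of the emulation stage -/

section FormulaSimulation

variable {m : ℕ} {F : ℕ → Type}

/-- The shares and messages that the parties obtain from a call of the functionality of a literal
with outputs `o`. -/
def callState [∀ κ, Zero (F κ)] {κ : ℕ} (ℓ : Literal F m) (o : ℓ.parties → F κ × Val (F κ)) :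
    State (Fin m) (F κ) :=
  (fun i => if h : i ∈ ℓ.parties then (o ⟨i, h⟩).1 else 0,
    fun i => if h : i ∈ ℓ.parties then [.elt (o ⟨i, h⟩).1, (o ⟨i, h⟩).2] else [])

theorem sum_callState [∀ κ, AddCommMonoid (F κ)] {κ : ℕ} (ℓ : Literal F m)
    (o : ℓ.parties → F κ × Val (F κ)) : ∑ i, (callState ℓ o).1 i = ∑ i, (o i).1 := by
  dsimp only [callState]
  rw [← Finset.sum_subset (Finset.subset_univ ℓ.parties) fun i _ hi => dif_neg hi,
    ← Finset.sum_coe_sort]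
  exact Finset.sum_congr rfl fun i _ => dif_pos i.2

/-- The outputs of all functionalities that are called along a formula. -/
def CallOutputs : Formula (Literal F m) → ℕ → Type
  | .lit ℓ, κ => ℓ.parties → F κ × Val (F κ)
  | .and φ ψ, κ => CallOutputs φ κ × CallOutputs ψ κ
  | .or φ ψ, κ => CallOutputs φ κ × CallOutputs ψ κ

/-- The law of the outputs of independent calls. -/
noncomputable def callLaw (κ : ℕ) (x : Fin m → Input) :
    (φ : Formula (Literal F m)) → PMF (CallOutputs φ κ)
  | .lit ℓ => ℓ.func κ fun i => x i
  | .and φ ψ => prodLaw (callLaw κ x φ) (callLaw κ x ψ)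
  | .or φ ψ => prodLaw (callLaw κ x φ) (callLaw κ x ψ)

variable [∀ κ, Field (F κ)]

/-- The secret at the end of the formula emulation. -/
def secret {κ : ℕ} : (φ : Formula (Literal F m)) → CallOutputs φ κ → F κ
  | .lit _, o => ∑ i, (o i).1
  | .and φ ψ, o => secret φ o.1 + secret ψ o.2
  | .or φ ψ, o => secret φ o.1 * secret ψ o.2

variable [NeZero m] [∀ κ, Fintype (F κ)]

/-- The simulation of what a coalition holds and has received after the emulation stage, given the
outputs of all calls. -/
noncomputable def simEmulation (C : Finset (Fin m)) {κ : ℕ} :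
    (φ : Formula (Literal F m)) → CallOutputs φ κ → PMF (State (Fin m) (F κ))
  | .lit ℓ, o => PMF.pure (restrict C (callState ℓ o))
  | .and φ ψ, o => (prodLaw (simEmulation C φ o.1) (simEmulation C ψ o.2)).map fun p =>
      combine p.1 p.2
  | .or φ ψ, o => (prodLaw (simEmulation C φ o.1) (simEmulation C ψ o.2)).bind fun p =>
      (simMul C p.1.1 p.2.1).map (receiveAfter (combine p.1 p.2).2)

theorem emulation_lit (κ : ℕ) (x : Fin m → Input) (ℓ : Literal F m) :
    emulation κ x (.lit ℓ) = (ℓ.func κ fun i => x i).map (callState ℓ) := rfl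

theorem emulation_and (κ : ℕ) (x : Fin m → Input) (φ ψ : Formula (Literal F m)) :
    emulation κ x (.and φ ψ) =
      (prodLaw (emulation κ x φ) (emulation κ x ψ)).map fun p => combine p.1 p.2 := by
  rw [prodLaw_map]
  rfl

theorem emulation_or (κ : ℕ) (x : Fin m → Input) (φ ψ : Formula (Literal F m)) :
    emulation κ x (.or φ ψ) = (prodLaw (emulation κ x φ) (emulation κ x ψ)).bind fun p =>
      (secureMul p.1.1 p.2.1).map (receiveAfter (combine p.1 p.2).2) := by
  rw [prodLaw_bind]
  rfl

theorem protocol_eq (φ : Formula (Literal F m)) (κ : ℕ) (x : Fin m → Input) :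
    protocol φ κ x = (emulation κ x φ).bind fun p => (transformation p.1).map fun q =>
      (fun i => Val.ofBits (x i) :: (p.2 i ++ q.2 i), q.1) := rfl

theorem observe_mul {C : Finset (Fin m)} (hC : C ≠ Finset.univ) {κ : ℕ}
    (p q : State (Fin m) (F κ)) :
    ((secureMul p.1 q.1).map (receiveAfter (combine p q).2)).map (observe C) =
      (simMul C (restrict C p).1 (restrict C q).1).map fun t => ((∑ i, p.1 i) * ∑ i, q.1 i,
        receiveAfter (combine (restrict C p) (restrict C q)).2 t) := by
  have h := congrArg (PMF.map (Prod.map id (receiveAfter (restrict C (combine p q)).2)))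
    (secureMul_map_observe hC p.1 q.1)
  rw [PMF.map_comp, PMF.map_comp] at h
  rw [PMF.map_comp, ← restrict_combine]
  simp only [restrict, simMul_piecewise] at h ⊢
  exact (congrArg (PMF.map · _) <| funext fun t => observe_receiveAfter C _ t).trans h

theorem emulation_map_observe {C : Finset (Fin m)} (hC : C ≠ Finset.univ) (κ : ℕ)
    (x : Fin m → Input) (φ : Formula (Literal F m)) :
    (emulation κ x φ).map (observe C) =
      (callLaw κ x φ).bind fun o => (simEmulation C φ o).map (Prod.mk (secret φ o)) := by
  induction φ with
  | lit ℓ =>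
    rw [emulation_lit, PMF.map_comp]
    refine congrArg (PMF.bind _) <| funext fun o => ?_
    simp only [simEmulation, PMF.pure_map, secret, ← sum_callState]
    rfl
  | and φ ψ ihφ ihψ => calc
    _ = (prodLaw ((emulation κ x φ).map (observe C)) ((emulation κ x ψ).map (observe C))).map
          fun q => (q.1.1 + q.2.1, combine q.1.2 q.2.2) := by
      simp only [emulation_and, prodLaw_map, PMF.map_bind, PMF.map_comp, PMF.bind_map,
        Function.comp_def, observe_combine]
    _ = _ := by
      simp only [ihφ, ihψ, callLaw, simEmulation, secret, prodLaw_map, PMF.map_bind,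
        PMF.bind_bind, PMF.map_comp, PMF.bind_map, Function.comp_def]
      refine Eq.trans ?_ (prodLaw_bind (callLaw κ x φ) (callLaw κ x ψ) _).symm
      exact congrArg _ <| funext fun o => PMF.bind_comm _ _ _
  | or φ ψ ihφ ihψ => calc
    _ = (prodLaw ((emulation κ x φ).map (observe C)) ((emulation κ x ψ).map (observe C))).bind
          fun q => (simMul C q.1.2.1 q.2.2.1).map fun t =>
            (q.1.1 * q.2.1, receiveAfter (combine q.1.2 q.2.2).2 t) := by
      simp only [emulation_or, prodLaw_bind, PMF.map_bind, observe_mul hC, PMF.bind_map,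
        Function.comp_def, observe]
    _ = _ := by
      simp only [ihφ, ihψ, callLaw, simEmulation, secret, prodLaw_bind, PMF.map_bind,
        PMF.bind_bind, PMF.map_comp, PMF.bind_map, Function.comp_def]
      refine Eq.trans ?_ (prodLaw_bind (callLaw κ x φ) (callLaw κ x ψ) _).symm
      exact congrArg _ <| funext fun o => PMF.bind_comm _ _ _

/-- The simulated views of the parties of a coalition, given the outputs of all calls and the shares
that the parties output. -/
noncomputable def simView (C : Finset (Fin m)) {κ : ℕ} (x : Fin m → Input)
    (φ : Formula (Literal F m)) (o : CallOutputs φ κ) (s : Fin m → F κ) :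
    PMF (Fin m → List (Val (F κ))) :=
  (simEmulation C φ o).bind fun p => (simTransformation C p.1 s).map fun w =>
    C.piecewise (fun i => Val.ofBits (x i) :: (p.2 i ++ w i)) fun _ => []

theorem transformation_map_view {C : Finset (Fin m)} (hC : C ≠ Finset.univ) {κ : ℕ}
    (x : Fin m → Input) (p : State (Fin m) (F κ)) :
    (transformation p.1).map (fun q => (q.1, C.piecewise
        (fun i => Val.ofBits (x i) :: (p.2 i ++ q.2 i)) fun _ => [])) =
      (idealPZS (∑ i, p.1 i = 0)).bind fun s =>
        (simTransformation C (restrict C p).1 s).map fun w => (s, C.piecewise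
          (fun i => Val.ofBits (x i) :: ((restrict C p).2 i ++ w i)) fun _ => []) := by
  have h := congrArg (PMF.map fun q => (q.1, C.piecewise
    (fun i => Val.ofBits (x i) :: ((restrict C p).2 i ++ q.2 i)) fun _ => []))
    (transformation_map_piecewise hC p.1)
  simp only [PMF.map_comp, PMF.map_bind, Function.comp_def] at h
  simp only [restrict, simTransformation_piecewise] at h ⊢
  rw [← h]
  exact congrArg (PMF.map · _) <| funext fun q => Prod.ext rfl <|
    C.piecewise_congr (fun i hi => by simp [hi]) fun _ _ => rfl

theorem protocol_map_view {C : Finset (Fin m)} (hC : C ≠ Finset.univ) (κ : ℕ) (x : Fin m → Input)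
    (φ : Formula (Literal F m)) :
    (protocol φ κ x).map (fun p => (p.2, C.piecewise p.1 fun _ => [])) =
      (callLaw κ x φ).bind fun o => (idealPZS (secret φ o = 0)).bind fun s =>
        (simView C x φ o s).map (Prod.mk s) := by
  calc
    _ = ((emulation κ x φ).map (observe C)).bind fun q => (idealPZS (q.1 = 0)).bind fun s =>
          (simTransformation C q.2.1 s).map fun w => (s, C.piecewise
            (fun i => Val.ofBits (x i) :: (q.2.2 i ++ w i)) fun _ => []) := by
      simp only [protocol_eq, PMF.map_bind, PMF.map_comp, PMF.bind_map, Function.comp_def,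
        transformation_map_view hC, observe]
    _ = _ := by
      simp only [emulation_map_observe hC, simView, PMF.map_bind, PMF.bind_map, PMF.bind_bind,
        PMF.map_comp, Function.comp_def]
      exact congrArg _ <| funext fun o => PMF.bind_comm _ _ _

end FormulaSimulation

/-! ### Correctness -/

section Correctness

theorem map_fun_const {α β : Type} (p : PMF α) (b : β) : p.map (fun _ => b) = PMF.pure b :=
  p.map_const b

section IdealFunctionality

variable {F : Type} [Field F] [Fintype F]

theorem toReal_uniformOfFintype_apply (a : F) :
    (PMF.uniformOfFintype F a).toReal = (Fintype.card F : ℝ)⁻¹ := by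
  simp

theorem prodLaw_idealSecret_map_add (Q Q' : Prop) :
    (prodLaw (idealSecret Q) (idealSecret Q')).map (fun r => r.1 + r.2) =
      (idealSecret (Q ∧ Q') : PMF F) := by
  rw [prodLaw_map]
  by_cases h' : Q'
  · rw [idealSecret_of_true h', and_iff_left h']
    simp only [PMF.pure_map, add_zero, PMF.bind_pure]
  · rw [idealSecret_of_false h', idealSecret_of_false fun h : Q ∧ Q' => h' h.2]
    simp only [uniformOfFintype_map_of_bijective (AddGroup.addLeft_bijective _), PMF.bind_const]

theorem tvDist_prodLaw_idealSecret_map_mul_le (Q Q' : Prop) :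
    tvDist ((prodLaw (idealSecret Q) (idealSecret Q')).map fun r => r.1 * r.2)
      (idealSecret (Q ∨ Q') : PMF F) ≤ (Fintype.card F : ℝ)⁻¹ := by
  rw [prodLaw_map]
  by_cases h : Q
  · rw [idealSecret_of_true (Q := Q ∨ Q') (Or.inl h), idealSecret_of_true h]
    simp [map_fun_const, tvDist_self]
  by_cases h' : Q'
  · rw [idealSecret_of_true (Q := Q ∨ Q') (Or.inr h'), idealSecret_of_true h']
    simp [PMF.pure_map, tvDist_self]
  rw [idealSecret_of_false h, idealSecret_of_false h', idealSecret_of_false (not_or.2 ⟨h, h'⟩),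
    ← toReal_uniformOfFintype_apply 0]
  conv_lhs => arg 2; rw [← (PMF.uniformOfFintype F).bind_const (PMF.uniformOfFintype F)]
  exact tvDist_bind_bind_le_apply _ 0 fun r hr =>
    uniformOfFintype_map_of_bijective (mulLeft_bijective₀ r hr)

theorem tvDist_idealSecret_bind_idealPZS_le {P : Type} [Fintype P] [DecidableEq P] [Nonempty P]
    (Q : Prop) : tvDist ((idealSecret Q : PMF F).bind fun r => (idealPZS (r = 0) : PMF (P → F)))
      (idealPZS Q) ≤ (Fintype.card F : ℝ)⁻¹ := by
  by_cases h : Q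
  · rw [idealSecret_of_true h, PMF.pure_bind, idealPZS_of_true h, idealPZS_of_true rfl, tvDist_self]
    positivity
  · rw [idealSecret_of_false h, ← (PMF.uniformOfFintype F).bind_const (idealPZS Q),
      ← toReal_uniformOfFintype_apply 0]
    refine tvDist_bind_bind_le_apply _ 0 fun r hr => ?_
    rw [idealPZS_of_false hr, idealPZS_of_false h]

theorem toOuterMeasure_idealSecret_wrong_le (Q : Prop) :
    ((idealSecret Q : PMF F).toOuterMeasure {r | ¬(r = 0 ↔ Q)}).toReal ≤
      (Fintype.card F : ℝ)⁻¹ := by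
  by_cases h : Q
  · rw [idealSecret_of_true h, PMF.toOuterMeasure_pure_apply, if_neg (by simp [h])]
    simp
  · rw [idealSecret_of_false h, ← toReal_uniformOfFintype_apply 0,
      show {r : F | ¬(r = 0 ↔ Q)} = {0} by ext; simp [h], PMF.toOuterMeasure_apply_singleton]

end IdealFunctionality

theorem natCast_mul_inv_le_inv_pow {n s c : ℕ} (h : n * 2 ^ s ≤ c) :
    n * (c : ℝ)⁻¹ ≤ (2 : ℝ)⁻¹ ^ s := by
  refine div_le_of_le_mul₀ c.cast_nonneg (by positivity) ?_
  rw [inv_pow, inv_mul_eq_div, le_div_iff₀ (by positivity)]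
  exact_mod_cast h

variable {m : ℕ} {F : ℕ → Type} [∀ κ, Field (F κ)]

theorem callLaw_map_secret_and (κ : ℕ) (x : Fin m → Input) (φ ψ : Formula (Literal F m)) :
    (callLaw κ x (.and φ ψ)).map (secret (.and φ ψ)) =
      (prodLaw ((callLaw κ x φ).map (secret φ)) ((callLaw κ x ψ).map (secret ψ))).map
        fun r => r.1 + r.2 := by
  refine (prodLaw_map (callLaw κ x φ) (callLaw κ x ψ) _).trans ?_
  simp only [prodLaw_map, PMF.bind_map, PMF.map_comp, Function.comp_def]
  rfl

theorem callLaw_map_secret_or (κ : ℕ) (x : Fin m → Input) (φ ψ : Formula (Literal F m)) :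
    (callLaw κ x (.or φ ψ)).map (secret (.or φ ψ)) =
      (prodLaw ((callLaw κ x φ).map (secret φ)) ((callLaw κ x ψ).map (secret ψ))).map
        fun r => r.1 * r.2 := by
  refine (prodLaw_map (callLaw κ x φ) (callLaw κ x ψ) _).trans ?_
  simp only [prodLaw_map, PMF.bind_map, PMF.map_comp, Function.comp_def]
  rfl

variable [∀ κ, Fintype (F κ)]

theorem tvDist_secret_lit_le (κ : ℕ) (x : Fin m → Input) (ℓ : Literal F m) :
    tvDist ((callLaw κ x (.lit ℓ)).map (secret (.lit ℓ))) (idealSecret (ℓ.pred fun i => x i)) ≤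
      ℓ.error κ x := by
  have h : (callLaw κ x (.lit ℓ)).map (secret (.lit ℓ)) =
      ((ℓ.func κ fun i => x i).map fun o i => (o i).1).map fun s => ∑ i, s i := by
    rw [PMF.map_comp]
    rfl
  rw [h, ← idealPZS_map_sum (P := ℓ.parties)]
  exact tvDist_map_le _ _ _

theorem tvDist_secret_le (κ : ℕ) (x : Fin m → Input) (φ : Formula (Literal F m)) :
    tvDist ((callLaw κ x φ).map (secret φ)) (idealSecret (φ.pred x)) ≤
      (φ.literals.map fun ℓ => ℓ.error κ x).sum + φ.numOr * (Fintype.card (F κ) : ℝ)⁻¹ := by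
  induction φ with
  | lit ℓ => simpa [Formula.literals, Formula.numOr, Formula.pred, Formula.Holds] using
      tvDist_secret_lit_le κ x ℓ
  | and φ ψ ihφ ihψ =>
    rw [callLaw_map_secret_and, show idealSecret (Formula.pred (.and φ ψ) x) = _ from
      (prodLaw_idealSecret_map_add (F := F κ) (φ.pred x) (ψ.pred x)).symm]
    refine ((tvDist_map_le _ _ _).trans (tvDist_prodLaw_le _ _ _ _)).trans
      ((add_le_add ihφ ihψ).trans_eq ?_)
    simp only [Formula.literals, Formula.numOr, List.map_append, List.sum_append, Nat.cast_add]
    ring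
  | or φ ψ ihφ ihψ =>
    rw [callLaw_map_secret_or]
    refine (tvDist_triangle _ _ _).trans ((add_le_add
      (((tvDist_map_le _ _ _).trans (tvDist_prodLaw_le _ _ _ _)).trans (add_le_add ihφ ihψ))
      (tvDist_prodLaw_idealSecret_map_mul_le (φ.pred x) (ψ.pred x))).trans_eq ?_)
    simp only [Formula.literals, Formula.numOr, List.map_append, List.sum_append, Nat.cast_add,
      Nat.cast_one]
    ring

theorem toOuterMeasure_secret_wrong_le (κ : ℕ) (x : Fin m → Input) (φ : Formula (Literal F m)) :
    ((callLaw κ x φ).toOuterMeasure {o | ¬(secret φ o = 0 ↔ φ.pred x)}).toReal ≤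
      tvDist ((callLaw κ x φ).map (secret φ)) (idealSecret (φ.pred x)) +
        (Fintype.card (F κ) : ℝ)⁻¹ := by
  have h := toOuterMeasure_sub_le_tvDist ((callLaw κ x φ).map (secret φ))
    (idealSecret (φ.pred x)) {r | ¬(r = 0 ↔ φ.pred x)}
  rw [PMF.toOuterMeasure_map_apply] at h
  exact (sub_le_iff_le_add.1 h).trans
    (add_le_add_right (toOuterMeasure_idealSecret_wrong_le _) _)

variable [NeZero m]

theorem emulation_map_sum (κ : ℕ) (x : Fin m → Input) (φ : Formula (Literal F m)) :
    (emulation κ x φ).map (fun p => ∑ i, p.1 i) = (callLaw κ x φ).map (secret φ) := by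
  have h := congrArg (PMF.map Prod.fst) (emulation_map_observe (C := ∅)
    Finset.univ_nonempty.ne_empty.symm κ x φ)
  rw [← PMF.bind_pure_comp (secret φ)]
  simpa only [PMF.map_comp, PMF.map_bind, Function.comp_def, observe, map_fun_const] using h

theorem protocol_map_output (κ : ℕ) (x : Fin m → Input) (φ : Formula (Literal F m)) :
    (protocol φ κ x).map (fun p => p.2) =
      ((callLaw κ x φ).map (secret φ)).bind fun r => idealPZS (r = 0) := by
  have h := congrArg (PMF.map Prod.fst) (protocol_map_view (C := ∅)
    Finset.univ_nonempty.ne_empty.symm κ x φ)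
  simpa only [PMF.map_comp, PMF.map_bind, PMF.bind_map, Function.comp_def, map_fun_const,
    PMF.bind_pure] using h

theorem tvDist_output_le (κ : ℕ) (x : Fin m → Input) (φ : Formula (Literal F m)) :
    tvDist ((protocol φ κ x).map fun p => p.2) (idealPZS (φ.pred x)) ≤
      tvDist ((callLaw κ x φ).map (secret φ)) (idealSecret (φ.pred x)) +
        (Fintype.card (F κ) : ℝ)⁻¹ := by
  rw [protocol_map_output]
  exact (tvDist_triangle _ _ _).trans
    (add_le_add (tvDist_bind_le _ _ _) (tvDist_idealSecret_bind_idealPZS_le _))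

end Correctness

/-! ### Running programs -/

section Run

variable {F : Type} [Field F] [Fintype F] {enc : F ↪ List Bool}

theorem run_seq (p q : Prog) (v : Val F) :
    (Prog.seq p q).run enc v = (p.run enc v).bind (q.run enc) := by
  simp only [Prog.run, Prog.exec, PMF.map_bind, PMF.map_comp, PMF.bind_map, Function.comp_def]

theorem run_pair (p q : Prog) (v : Val F) : (Prog.pair p q).run enc v =
    (p.run enc v).bind fun a => (q.run enc v).map fun b => Val.pair a b := by
  simp only [Prog.run, Prog.exec, PMF.map_bind, PMF.map_comp, PMF.bind_map, Function.comp_def]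

theorem exec_cond_of_ne_nil (p q : Prog) {c : Val F} (hc : c ≠ .nil) (w : Val F) :
    (Prog.cond p q).exec enc (.pair c w) = (p.exec enc w).map fun r => (r.1, r.2 + 1) := by
  cases c with
  | nil => exact absurd rfl hc
  | elt x => rfl
  | pair a b => rfl

theorem run_cond_nil (p q : Prog) (w : Val F) :
    (Prog.cond p q).run enc (.pair .nil w) = q.run enc w := by
  simp only [Prog.run, Prog.exec, PMF.map_comp, Function.comp_def]

theorem run_cond_of_ne_nil (p q : Prog) {c : Val F} (hc : c ≠ .nil) (w : Val F) :
    (Prog.cond p q).run enc (.pair c w) = p.run enc w := by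
  simp only [Prog.run, exec_cond_of_ne_nil p q hc, PMF.map_comp, Function.comp_def]

theorem mem_support_run {p : Prog} {v : Val F} {r : Val F × ℕ}
    (h : r ∈ (p.exec enc v).support) : r.1 ∈ (p.run enc v).support := by
  rw [Prog.run, PMF.support_map]
  exact ⟨r, h, rfl⟩

theorem Prog.CostLE.mono {p : Prog} {v : Val F} {c d : ℕ} (h : p.CostLE enc v c) (hcd : c ≤ d) :
    p.CostLE enc v d := fun r hr => (h r hr).trans hcd

theorem costLE_seq {p q : Prog} {v : Val F} {c d : ℕ} (hp : p.CostLE enc v c)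
    (hq : ∀ w ∈ (p.run enc v).support, q.CostLE enc w d) :
    (Prog.seq p q).CostLE enc v (c + d + 1) := by
  intro r hr
  simp only [Prog.exec, PMF.mem_support_bind_iff, PMF.mem_support_map_iff] at hr
  obtain ⟨s, hs, t, ht, rfl⟩ := hr
  have hsc := hp s hs
  have htd := hq _ (mem_support_run hs) t ht
  dsimp only
  omega

theorem costLE_pair {p q : Prog} {v : Val F} {c d : ℕ} (hp : p.CostLE enc v c)
    (hq : q.CostLE enc v d) : (Prog.pair p q).CostLE enc v (c + d + 1) := by
  intro r hr
  simp only [Prog.exec, PMF.mem_support_bind_iff, PMF.mem_support_map_iff] at hr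
  obtain ⟨s, hs, t, ht, rfl⟩ := hr
  have hsc := hp s hs
  have htd := hq t ht
  dsimp only
  omega

theorem costLE_cond_nil {p q : Prog} {w : Val F} {c : ℕ} (hq : q.CostLE enc w c) :
    (Prog.cond p q).CostLE enc (.pair .nil w) (c + 1) := by
  intro r hr
  rw [Prog.exec, PMF.mem_support_map_iff] at hr
  obtain ⟨t, ht, rfl⟩ := hr
  exact Nat.succ_le_succ (hq t ht)

theorem costLE_cond_of_ne_nil {p q : Prog} {v w : Val F} {c : ℕ} (hv : v ≠ .nil)
    (hp : p.CostLE enc w c) : (Prog.cond p q).CostLE enc (.pair v w) (c + 1) := by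
  intro r hr
  rw [exec_cond_of_ne_nil p q hv, PMF.mem_support_map_iff] at hr
  obtain ⟨t, ht, rfl⟩ := hr
  exact Nat.succ_le_succ (hp t ht)

end Run

/-! ### Programs of constant running time -/

section ConstantTime

variable {F : ℕ → Type} [∀ κ, Field (F κ)] [∀ κ, Fintype (F κ)] (enc : ∀ κ, F κ ↪ List Bool)
  {ι : Type}

/-- Some program that halts within a constant number of steps on all data, including those that
encode nothing, samples from `f a` when it is given the encoding `e a`. The index `a` ranges over
the relevant inputs and `k a` is the value of the security parameter that belongs to `a`. -/
def ConstTimeSamplable (k : ι → ℕ) (e : ∀ a, Val (F (k a))) (f : ∀ a, PMF (Val (F (k a)))) :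
    Prop :=
  ∃ (p : Prog) (c : ℕ), (∀ κ v, p.CostLE (enc κ) v c) ∧ ∀ a, p.run (enc (k a)) (e a) = f a

/-- Some program that halts within a constant number of steps on all data computes `f a` from the
encoding `e a`. -/
def ConstTimeComputable (k : ι → ℕ) (e f : ∀ a, Val (F (k a))) : Prop :=
  ConstTimeSamplable enc k e fun a => PMF.pure (f a)

variable {enc} {k : ι → ℕ} {e : ∀ a, Val (F (k a))}

namespace ConstTimeSamplable

theorem congr {f f' : ∀ a, PMF (Val (F (k a)))} (h : ConstTimeSamplable enc k e f)
    (hf : ∀ a, f a = f' a) : ConstTimeSamplable enc k e f' := by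
  rwa [← funext hf]

theorem reindex {f : ∀ a, PMF (Val (F (k a)))} (h : ConstTimeSamplable enc k e f) {ι' : Type}
    (g : ι' → ι) :
    ConstTimeSamplable enc (fun a => k (g a)) (fun a => e (g a)) fun a => f (g a) := by
  obtain ⟨p, c, hc, hp⟩ := h
  exact ⟨p, c, hc, fun a => hp (g a)⟩

theorem of_exec {p : Prog} {X : ∀ κ, Val (F κ) → PMF (Val (F κ))}
    (hp : ∀ κ v, p.exec (enc κ) v = (X κ v).map fun w => (w, 1)) :
    ConstTimeSamplable enc k e fun a => X (k a) (e a) := by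
  refine ⟨p, 1, fun κ v r hr => ?_, fun a => ?_⟩
  · rw [hp, PMF.mem_support_map_iff] at hr
    obtain ⟨w, _, rfl⟩ := hr
    exact le_rfl
  · rw [Prog.run, hp, PMF.map_comp]
    exact PMF.map_id _

theorem pair {f g : ∀ a, PMF (Val (F (k a)))} (hf : ConstTimeSamplable enc k e f)
    (hg : ConstTimeSamplable enc k e g) :
    ConstTimeSamplable enc k e fun a => (f a).bind fun x => (g a).map fun y => .pair x y := by
  obtain ⟨p, c, hc, hp⟩ := hf
  obtain ⟨q, d, hd, hq⟩ := hg
  refine ⟨.pair p q, c + d + 1, fun κ v => costLE_pair (hc κ v) (hd κ v), fun a => ?_⟩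
  rw [run_pair, hp, hq]

theorem prodLaw {β γ : ι → Type} {X : ∀ a, PMF (β a)} {Y : ∀ a, PMF (γ a)}
    {e' : ∀ a, β a → Val (F (k a))} {e'' : ∀ a, γ a → Val (F (k a))}
    (hX : ConstTimeSamplable enc k e fun a => (X a).map (e' a))
    (hY : ConstTimeSamplable enc k e fun a => (Y a).map (e'' a)) :
    ConstTimeSamplable enc k e fun a =>
      (PZS.prodLaw (X a) (Y a)).map fun p => .pair (e' a p.1) (e'' a p.2) :=
  (hX.pair hY).congr fun a => by
    simp only [prodLaw_map, PMF.bind_map, PMF.map_comp, Function.comp_def]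

end ConstTimeSamplable

theorem ConstTimeComputable.self : ConstTimeComputable enc k e e :=
  .of_exec (p := .skip) (X := fun _ => PMF.pure) fun _ _ => by
    rw [PMF.pure_map]
    rfl

namespace ConstTimeSamplable

theorem bind {β : ι → Type} {X : ∀ a, PMF (β a)} {e' : ∀ a, β a → Val (F (k a))}
    {g : ∀ a, β a → PMF (Val (F (k a)))}
    (h : ConstTimeSamplable enc k e fun a => (X a).map (e' a))
    (hg : ConstTimeSamplable enc (ι := {p : Σ a, β a // p.2 ∈ (X p.1).support}) (fun p => k p.1.1)
      (fun p => .pair (e p.1.1) (e' p.1.1 p.1.2)) fun p => g p.1.1 p.1.2) :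
    ConstTimeSamplable enc k e fun a => (X a).bind (g a) := by
  obtain ⟨p, c, hc, hp⟩ := ConstTimeComputable.self.pair h
  simp only [PMF.pure_bind, PMF.map_comp] at hp
  obtain ⟨q, d, hd, hq⟩ := hg
  refine ⟨.seq p q, c + d + 1, fun κ v => costLE_seq (hc κ v) fun w _ => hd κ w, fun a => ?_⟩
  rw [run_seq, hp, PMF.bind_map]
  exact bind_congr_of_support _ fun b hb => hq ⟨⟨a, b⟩, hb⟩

theorem map {β : ι → Type} {X : ∀ a, PMF (β a)} {e' g : ∀ a, β a → Val (F (k a))}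
    (h : ConstTimeSamplable enc k e fun a => (X a).map (e' a))
    (hg : ConstTimeComputable enc (ι := {p : Σ a, β a // p.2 ∈ (X p.1).support})
      (fun p => k p.1.1) (fun p => .pair (e p.1.1) (e' p.1.1 p.1.2)) fun p => g p.1.1 p.1.2) :
    ConstTimeSamplable enc k e fun a => (X a).map (g a) :=
  bind (g := fun a b => PMF.pure (g a b)) h hg

end ConstTimeSamplable

namespace ConstTimeComputable

theorem congr {f f' : ∀ a, Val (F (k a))} (h : ConstTimeComputable enc k e f)
    (hf : ∀ a, f a = f' a) : ConstTimeComputable enc k e f' := by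
  rwa [← funext hf]

theorem reindex {f : ∀ a, Val (F (k a))} (h : ConstTimeComputable enc k e f) {ι' : Type}
    (g : ι' → ι) :
    ConstTimeComputable enc (fun a => k (g a)) (fun a => e (g a)) fun a => f (g a) :=
  ConstTimeSamplable.reindex h g

theorem comp_samplable {f : ∀ a, Val (F (k a))} {g : ∀ a, PMF (Val (F (k a)))}
    (hf : ConstTimeComputable enc k e f) (hg : ConstTimeSamplable enc k f g) :
    ConstTimeSamplable enc k e g := by
  obtain ⟨p, c, hc, hp⟩ := hf
  obtain ⟨q, d, hd, hq⟩ := hg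
  refine ⟨.seq p q, c + d + 1, fun κ v => costLE_seq (hc κ v) fun w _ => hd κ w, fun a => ?_⟩
  rw [run_seq, hp, PMF.pure_bind, hq]

theorem comp_of_exec {p : Prog} {g : ∀ κ, Val (F κ) → Val (F κ)} {f : ∀ a, Val (F (k a))}
    (hf : ConstTimeComputable enc k e f)
    (hp : ∀ κ v, p.exec (enc κ) v = PMF.pure (g κ v, 1)) :
    ConstTimeComputable enc k e fun a => g (k a) (f a) :=
  hf.comp_samplable <| .of_exec (X := fun κ v => PMF.pure (g κ v)) fun κ v => by
    rw [hp, PMF.pure_map]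

theorem nil : ConstTimeComputable enc k e fun _ => .nil :=
  self.comp_of_exec (p := .nil) (g := fun _ _ => .nil) fun _ _ => rfl

theorem pair {f g : ∀ a, Val (F (k a))} (hf : ConstTimeComputable enc k e f)
    (hg : ConstTimeComputable enc k e g) : ConstTimeComputable enc k e fun a => .pair (f a) (g a) :=
  (ConstTimeSamplable.pair hf hg).congr fun a => by rw [PMF.pure_bind, PMF.pure_map]

theorem head {f : ∀ a, Val (F (k a))} (h : ConstTimeComputable enc k e f) :
    ConstTimeComputable enc k e fun a => (f a).head :=
  h.comp_of_exec (p := .head) (g := fun _ => Val.head) fun _ _ => rfl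

theorem tail {f : ∀ a, Val (F (k a))} (h : ConstTimeComputable enc k e f) :
    ConstTimeComputable enc k e fun a => (f a).tail :=
  h.comp_of_exec (p := .tail) (g := fun _ => Val.tail) fun _ _ => rfl

theorem fst {f g : ∀ a, Val (F (k a))}
    (h : ConstTimeComputable enc k e fun a => .pair (f a) (g a)) : ConstTimeComputable enc k e f :=
  h.head

theorem snd {f g : ∀ a, Val (F (k a))}
    (h : ConstTimeComputable enc k e fun a => .pair (f a) (g a)) : ConstTimeComputable enc k e g :=
  h.tail

theorem weaken {f : ∀ a, Val (F (k a))} (h : ConstTimeComputable enc k e f) {ι' : Type} (g : ι' → ι)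
    {v : ∀ a, Val (F (k (g a)))} :
    ConstTimeComputable enc (fun a => k (g a)) (fun a => .pair (e (g a)) (v a)) fun a => f (g a) :=
  self.fst.comp_samplable (h.reindex g)

section Field

variable {f g : ∀ a, F (k a)}

theorem one : ConstTimeComputable enc k e fun _ => .elt 1 :=
  self.comp_of_exec (p := .one) (g := fun _ _ => .elt 1) fun _ _ => rfl

theorem add (hf : ConstTimeComputable enc k e fun a => .elt (f a))
    (hg : ConstTimeComputable enc k e fun a => .elt (g a)) :
    ConstTimeComputable enc k e fun a => .elt (f a + g a) :=
  (hf.pair hg).comp_of_exec (p := .add) (g := fun _ => Val.binop (· + ·)) fun _ _ => rfl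

theorem mul (hf : ConstTimeComputable enc k e fun a => .elt (f a))
    (hg : ConstTimeComputable enc k e fun a => .elt (g a)) :
    ConstTimeComputable enc k e fun a => .elt (f a * g a) :=
  (hf.pair hg).comp_of_exec (p := .mul) (g := fun _ => Val.binop (· * ·)) fun _ _ => rfl

theorem neg (hf : ConstTimeComputable enc k e fun a => .elt (f a)) :
    ConstTimeComputable enc k e fun a => .elt (-f a) :=
  hf.comp_of_exec (p := .neg) (g := fun _ => Val.unop (- ·)) fun _ _ => rfl

theorem sub (hf : ConstTimeComputable enc k e fun a => .elt (f a))
    (hg : ConstTimeComputable enc k e fun a => .elt (g a)) :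
    ConstTimeComputable enc k e fun a => .elt (f a - g a) := by
  simpa only [sub_eq_add_neg] using hf.add hg.neg

theorem zero : ConstTimeComputable enc k e fun _ => .elt 0 := by
  simpa only [sub_self] using one.sub one

theorem sum {P : Type} (s : Finset P) {f : ∀ a, P → F (k a)}
    (hf : ∀ i ∈ s, ConstTimeComputable enc k e fun a => .elt (f a i)) :
    ConstTimeComputable enc k e fun a => .elt (∑ i ∈ s, f a i) := by
  classical
  induction s using Finset.induction_on with
  | empty => simpa using zero
  | insert i s hi ih =>
    simp only [Finset.sum_insert hi]
    exact (hf i (Finset.mem_insert_self i s)).add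
      (ih fun j hj => hf j (Finset.mem_insert_of_mem hj))

end Field

section Lists

variable {P : Type} {w : ∀ a, P → Val (F (k a))}

theorem ofList_map (l : List P) (hw : ∀ i ∈ l, ConstTimeComputable enc k e fun a => w a i) :
    ConstTimeComputable enc k e fun a => .ofList (l.map (w a)) := by
  induction l with
  | nil => exact nil
  | cons i l ih =>
    exact (hw i List.mem_cons_self).pair (ih fun j hj => hw j (List.mem_cons_of_mem i hj))

theorem of_ofList_map {l : List P} (h : ConstTimeComputable enc k e fun a => .ofList (l.map (w a)))
    {i : P} (hi : i ∈ l) : ConstTimeComputable enc k e fun a => w a i := by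
  induction l with
  | nil => exact absurd hi List.not_mem_nil
  | cons j l ih =>
    rcases List.mem_cons.1 hi with rfl | hi
    · exact h.fst
    · exact ih h.snd hi

theorem ofList_append {n : ℕ} {l l' : ∀ a, List (Val (F (k a)))} (hn : ∀ a, (l a).length = n)
    (hl : ConstTimeComputable enc k e fun a => .ofList (l a))
    (hl' : ConstTimeComputable enc k e fun a => .ofList (l' a)) :
    ConstTimeComputable enc k e fun a => .ofList (l a ++ l' a) := by
  induction n generalizing l with
  | zero => exact hl'.congr fun a => by rw [List.length_eq_zero_iff.1 (hn a), List.nil_append]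
  | succ n ih =>
    choose x t hxt using fun a => List.exists_cons_of_length_eq_add_one (hn a)
    simp only [hxt, List.length_cons, Nat.add_right_cancel_iff, List.cons_append] at hn hl ⊢
    exact hl.fst.pair (ih hn hl.snd)

variable [Fintype P] [LinearOrder P]

theorem restrictTo (C : Finset P) (hw : ∀ i ∈ C, ConstTimeComputable enc k e fun a => w a i) :
    ConstTimeComputable enc k e fun a => restrictTo C (w a) := by
  refine ofList_map _ fun i _ => ?_
  by_cases hi : i ∈ C
  · simp only [hi, if_true]
    exact (hw i hi).pair nil
  · simp only [hi, if_false]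
    exact nil

theorem restrictTo_entry {C : ι → Finset P}
    (h : ConstTimeComputable enc k e fun a => PZS.restrictTo (C a) (w a)) (i : P) :
    ConstTimeComputable enc k e fun a =>
      Val.ofOption (if i ∈ C a then some (w a i) else none) :=
  of_ofList_map h ((Finset.mem_sort _).2 (Finset.mem_univ i))

theorem of_restrictTo {C : Finset P}
    (h : ConstTimeComputable enc k e fun a => PZS.restrictTo C (w a)) {i : P} (hi : i ∈ C) :
    ConstTimeComputable enc k e fun a => w a i := by
  have hentry := restrictTo_entry (C := fun _ => C) h i
  simp only [hi, if_true] at hentry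
  exact hentry.fst

theorem of_sharesVal {s : ∀ a, P → F (k a)}
    (h : ConstTimeComputable enc k e fun a => sharesVal (s a)) (i : P) :
    ConstTimeComputable enc k e fun a => .elt (s a i) :=
  of_restrictTo h (Finset.mem_univ i)

end Lists

end ConstTimeComputable

section UniformSampling

theorem uniformOfFintype_bind_update {P K α : Type} [Fintype P] [DecidableEq P] [Field K]
    [Fintype K] (i : P) (g : (P → K) → PMF α) :
    ((PMF.uniformOfFintype K).bind fun x =>
      (PMF.uniformOfFintype (P → K)).bind fun s => g (Function.update s i x)) =
      (PMF.uniformOfFintype (P → K)).bind g := by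
  have hupdate (s : P → K) (x : K) : s + Pi.single i x = Function.update s i (s i + x) := by
    ext j
    obtain rfl | hj := eq_or_ne j i <;> simp [*]
  calc
    _ = (PMF.uniformOfFintype (P → K)).bind fun s => (PMF.uniformOfFintype K).bind fun x =>
          g (Function.update s i x) := PMF.bind_comm _ _ _
    _ = (PMF.uniformOfFintype (P → K)).bind fun s => (PMF.uniformOfFintype K).bind fun x =>
          g (s + Pi.single i x) := by
      refine congrArg _ <| funext fun s => ?_
      simp only [hupdate]
      exact (uniformOfFintype_bind_of_bijective (AddGroup.addLeft_bijective (s i))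
        fun x => g (Function.update s i x)).symm
    _ = (PMF.uniformOfFintype K).bind fun x => (PMF.uniformOfFintype (P → K)).bind fun s =>
          g (s + Pi.single i x) := PMF.bind_comm _ _ _
    _ = _ := by
      simp only [uniformOfFintype_bind_of_bijective (AddGroup.addRight_bijective _),
        PMF.bind_const]

theorem uniformOfFintype_map_list_cons {P K : Type} [Fintype P] [DecidableEq P] [Field K]
    [Fintype K] {i : P} {l : List P} (hi : i ∉ l) :
    (PMF.uniformOfFintype (P → K)).map (fun s => (i :: l).map s) =
      (prodLaw (PMF.uniformOfFintype K) (PMF.uniformOfFintype (P → K))).map fun q =>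
        q.1 :: l.map q.2 := by
  rw [prodLaw_map, PMF.map, ← uniformOfFintype_bind_update i]
  refine congrArg _ <| funext fun x => congrArg _ <| funext fun s => congrArg PMF.pure ?_
  simp only [List.map_cons, Function.update_self]
  exact congrArg _ <| List.map_congr_left fun j hj =>
    Function.update_of_ne (fun h : j = i => hi (h ▸ hj)) _ _

namespace ConstTimeSamplable

theorem uniform_elt : ConstTimeSamplable enc k e fun a =>
    (PMF.uniformOfFintype (F (k a))).map fun x => .elt x :=
  .of_exec (p := .unif) (X := fun κ _ => (PMF.uniformOfFintype (F κ)).map fun x => .elt x)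
    fun κ v => by
      rw [PMF.map_comp]
      rfl

variable {P : Type} [Fintype P]

theorem uniform_list [DecidableEq P] {l : List P} (hl : l.Nodup) :
    ConstTimeSamplable enc k e fun a => (PMF.uniformOfFintype (P → F (k a))).map fun s =>
      .ofList ((l.map s).map fun x => .pair (.elt x) .nil) := by
  induction l with
  | nil => exact ConstTimeSamplable.congr ConstTimeComputable.nil fun a => (map_fun_const _ _).symm
  | cons i l ih =>
    rw [List.nodup_cons] at hl
    have hhead : ConstTimeSamplable enc k e fun a =>
        (PMF.uniformOfFintype (F (k a))).map fun x => .pair (.elt x) .nil :=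
      ConstTimeSamplable.map (β := fun a => F (k a)) uniform_elt <|
        ConstTimeComputable.self.snd.pair .nil
    refine (hhead.prodLaw (ih hl.2)).congr fun a => ?_
    have h := congrArg (PMF.map fun l => Val.ofList (l.map fun x => Val.pair (.elt x) .nil))
      (uniformOfFintype_map_list_cons (K := F (k a)) hl.1)
    rw [PMF.map_comp, PMF.map_comp] at h
    exact h.symm

theorem uniform_sharesVal [LinearOrder P] : ConstTimeSamplable enc k e fun a =>
    (PMF.uniformOfFintype (P → F (k a))).map sharesVal := by
  refine (uniform_list (Finset.sort_nodup (Finset.univ : Finset P) (· ≤ ·))).congr fun a => ?_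
  refine congrArg (fun f => PMF.map f _) (funext fun s => ?_)
  simp only [sharesVal, restrictTo, Finset.mem_univ, if_true, List.map_map]
  rfl

end ConstTimeSamplable

end UniformSampling

end ConstantTime

/-! ### Programs of polynomial running time -/

section PolynomialTime

theorem polynomial_eval_mono (T : Polynomial ℕ) : Monotone T.eval := fun a b h => by
  simp only [Polynomial.eval_eq_sum, Polynomial.sum]
  gcongr

variable {F : ℕ → Type} [∀ κ, Field (F κ)] [∀ κ, Fintype (F κ)] (enc : ∀ κ, F κ ↪ List Bool)
  {ι : Type}

/-- Some program samples from `f a` when it is given the encoding `e a`, in a number of steps that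
is polynomial in the size `n a`. -/
def PolyTimeSamplable (k : ι → ℕ) (e : ∀ a, Val (F (k a))) (n : ι → ℕ)
    (f : ∀ a, PMF (Val (F (k a)))) : Prop :=
  ∃ (p : Prog) (T : Polynomial ℕ),
    ∀ a, p.CostLE (enc (k a)) (e a) (T.eval (n a)) ∧ p.run (enc (k a)) (e a) = f a

variable {enc} {k : ι → ℕ} {e : ∀ a, Val (F (k a))} {n : ι → ℕ}

theorem ConstTimeSamplable.polyTimeSamplable {f : ∀ a, PMF (Val (F (k a)))}
    (h : ConstTimeSamplable enc k e f) : PolyTimeSamplable enc k e n f := by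
  obtain ⟨p, c, hc, hp⟩ := h
  exact ⟨p, Polynomial.C c, fun a => ⟨by rw [Polynomial.eval_C]; exact hc _ _, hp a⟩⟩

theorem ConstTimeComputable.comp_polyTimeSamplable {f : ∀ a, Val (F (k a))}
    {g : ∀ a, PMF (Val (F (k a)))} (hf : ConstTimeComputable enc k e f)
    (hg : PolyTimeSamplable enc k f n g) : PolyTimeSamplable enc k e n g := by
  obtain ⟨p, c, hc, hp⟩ := hf
  obtain ⟨q, U, hq⟩ := hg
  refine ⟨.seq p q, Polynomial.C c + U + 1, fun a => ⟨?_, ?_⟩⟩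
  · rw [Polynomial.eval_add, Polynomial.eval_add, Polynomial.eval_one, Polynomial.eval_C]
    refine costLE_seq (hc _ _) fun w hw => ?_
    rw [hp, PMF.support_pure, Set.mem_singleton_iff] at hw
    exact hw ▸ (hq a).1
  · rw [run_seq, hp, PMF.pure_bind, (hq a).2]

namespace PolyTimeSamplable

theorem congr {f f' : ∀ a, PMF (Val (F (k a)))} (h : PolyTimeSamplable enc k e n f)
    (hf : ∀ a, f a = f' a) : PolyTimeSamplable enc k e n f' := by
  rwa [← funext hf]

theorem mono {n' : ι → ℕ} {f : ∀ a, PMF (Val (F (k a)))} (h : PolyTimeSamplable enc k e n f)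
    (hn : ∀ a, n a ≤ n' a) : PolyTimeSamplable enc k e n' f := by
  obtain ⟨p, T, h⟩ := h
  exact ⟨p, T, fun a => ⟨(h a).1.mono (polynomial_eval_mono T (hn a)), (h a).2⟩⟩

theorem reindex {f : ∀ a, PMF (Val (F (k a)))} (h : PolyTimeSamplable enc k e n f) {ι' : Type}
    (g : ι' → ι) : PolyTimeSamplable enc (fun a => k (g a)) (fun a => e (g a)) (fun a => n (g a))
      fun a => f (g a) := by
  obtain ⟨p, T, h⟩ := h
  exact ⟨p, T, fun a => h (g a)⟩

theorem pair {f g : ∀ a, PMF (Val (F (k a)))} (hf : PolyTimeSamplable enc k e n f)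
    (hg : PolyTimeSamplable enc k e n g) :
    PolyTimeSamplable enc k e n fun a => (f a).bind fun x => (g a).map fun y => .pair x y := by
  obtain ⟨p, T, hp⟩ := hf
  obtain ⟨q, U, hq⟩ := hg
  refine ⟨.pair p q, T + U + 1, fun a => ⟨?_, ?_⟩⟩
  · rw [Polynomial.eval_add, Polynomial.eval_add, Polynomial.eval_one]
    exact costLE_pair (hp a).1 (hq a).1
  · rw [run_pair, (hp a).2, (hq a).2]

theorem bind {β : ι → Type} {X : ∀ a, PMF (β a)} {e' : ∀ a, β a → Val (F (k a))}
    {g : ∀ a, β a → PMF (Val (F (k a)))}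
    (h : PolyTimeSamplable enc k e n fun a => (X a).map (e' a))
    (hg : PolyTimeSamplable enc (ι := {p : Σ a, β a // p.2 ∈ (X p.1).support}) (fun p => k p.1.1)
      (fun p => .pair (e p.1.1) (e' p.1.1 p.1.2)) (fun p => n p.1.1) fun p => g p.1.1 p.1.2) :
    PolyTimeSamplable enc k e n fun a => (X a).bind (g a) := by
  obtain ⟨p, T, hp⟩ := ConstTimeComputable.self.polyTimeSamplable.pair h
  simp only [PMF.pure_bind, PMF.map_comp] at hp
  obtain ⟨q, U, hq⟩ := hg
  refine ⟨.seq p q, T + U + 1, fun a => ⟨?_, ?_⟩⟩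
  · rw [Polynomial.eval_add, Polynomial.eval_add, Polynomial.eval_one]
    refine costLE_seq (hp a).1 fun w hw => ?_
    rw [(hp a).2, PMF.mem_support_map_iff] at hw
    obtain ⟨b, hb, rfl⟩ := hw
    exact (hq ⟨⟨a, b⟩, hb⟩).1
  · rw [run_seq, (hp a).2, PMF.bind_map]
    exact bind_congr_of_support _ fun b hb => (hq ⟨⟨a, b⟩, hb⟩).2

theorem cases_nil {c : ∀ a, Val (F (k a))} {f : ∀ a, PMF (Val (F (k a)))}
    (hc : ConstTimeComputable enc k e c)
    (hne : PolyTimeSamplable enc (ι := {a // c a ≠ .nil}) (fun a => k a) (fun a => e a)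
      (fun a => n a) fun a => f a)
    (hnil : PolyTimeSamplable enc (ι := {a // c a = .nil}) (fun a => k a) (fun a => e a)
      (fun a => n a) fun a => f a) : PolyTimeSamplable enc k e n f := by
  obtain ⟨p, T, hp⟩ := hne
  obtain ⟨q, U, hq⟩ := hnil
  refine (hc.pair .self).comp_polyTimeSamplable ⟨.cond p q, T + U + 1, fun a => ?_⟩
  rw [Polynomial.eval_add, Polynomial.eval_add, Polynomial.eval_one]
  by_cases h : c a = .nil
  · simp only [h]
    exact ⟨(costLE_cond_nil (hq ⟨a, h⟩).1).mono (by dsimp only; omega),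
      (run_cond_nil _ _ _).trans (hq ⟨a, h⟩).2⟩
  · exact ⟨(costLE_cond_of_ne_nil h (hp ⟨a, h⟩).1).mono (by dsimp only; omega),
      (run_cond_of_ne_nil _ _ h _).trans (hp ⟨a, h⟩).2⟩

section Cases

variable {P : Type} {C : ι → Finset P} {f : ∀ a, PMF (Val (F (k a)))}

theorem cases_inter [DecidableEq P] (S : Finset P)
    (hC : ∀ i, ∃ c : ∀ a, Val (F (k a)), ConstTimeComputable enc k e c ∧
      ∀ a, c a ≠ .nil ↔ i ∈ C a)
    (h : ∀ D, PolyTimeSamplable enc (ι := {a // C a ∩ S = D}) (fun a => k a) (fun a => e a)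
      (fun a => n a) fun a => f a) : PolyTimeSamplable enc k e n f := by
  induction S using Finset.induction_on with
  | empty => exact (h ∅).reindex fun a => ⟨a, Finset.inter_empty _⟩
  | insert i S _ ih =>
    obtain ⟨c, hc, hci⟩ := hC i
    refine ih fun D => cases_nil (hc.reindex fun a : {a // C a ∩ S = D} => a.1)
      ((h (insert i D)).reindex
        fun a : {a : {a // C a ∩ S = D} // c a ≠ .nil} => ⟨a.1.1, ?_⟩)
      ((h D).reindex fun a : {a : {a // C a ∩ S = D} // c a = .nil} => ⟨a.1.1, ?_⟩)
    · rw [Finset.inter_insert_of_mem ((hci _).1 a.2), a.1.2]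
    · rw [Finset.inter_insert_of_notMem fun hi => (hci _).2 hi a.2, a.1.2]

theorem cases_finset [Finite P]
    (hC : ∀ i, ∃ c : ∀ a, Val (F (k a)), ConstTimeComputable enc k e c ∧
      ∀ a, c a ≠ .nil ↔ i ∈ C a)
    (h : ∀ D, PolyTimeSamplable enc (ι := {a // C a = D}) (fun a => k a) (fun a => e a)
      (fun a => n a) fun a => f a) : PolyTimeSamplable enc k e n f := by
  classical
  have := Fintype.ofFinite P
  exact cases_inter Finset.univ hC fun D => (h D).reindex
    fun a : {a // C a ∩ Finset.univ = D} => ⟨a.1, (Finset.inter_univ _).symm.trans a.2⟩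

end Cases

end PolyTimeSamplable

end PolynomialTime

/-! ### Running time of the simulation -/

section Encodings

theorem restrictTo_congr {P K : Type} [Fintype P] [LinearOrder P] {C : Finset P}
    {w w' : P → Val K} (h : ∀ i ∈ C, w i = w' i) : restrictTo C w = restrictTo C w' := by
  refine congrArg Val.ofList <| List.map_congr_left fun i _ => ?_
  by_cases hi : i ∈ C
  · simp only [hi, if_true, h]
  · simp only [hi, if_false]

variable {m : ℕ}

/-- The parties of a literal that belong to a coalition. -/
def Literal.inside {F : ℕ → Type} (ℓ : Literal F m) (C : Finset (Fin m)) : Finset ℓ.parties :=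
  C.subtype (· ∈ ℓ.parties)

theorem Literal.mem_inside {F : ℕ → Type} {ℓ : Literal F m} {C : Finset (Fin m)}
    {i : ℓ.parties} : i ∈ ℓ.inside C ↔ (i : Fin m) ∈ C := Finset.mem_subtype

/-- Encoding of what a coalition receives from the functionalities. -/
def encodeCalls {F : ℕ → Type} (C : Finset (Fin m)) {κ : ℕ} :
    (φ : Formula (Literal F m)) → CallOutputs φ κ → Val (F κ)
  | .lit ℓ, o => restrictTo (ℓ.inside C) fun i => .pair (.elt (o i).1) (o i).2
  | .and φ ψ, o => .pair (encodeCalls C φ o.1) (encodeCalls C ψ o.2)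
  | .or φ ψ, o => .pair (encodeCalls C φ o.1) (encodeCalls C ψ o.2)

/-- Encoding of what a coalition knows of a state. -/
def encodeState {K : Type} (C : Finset (Fin m)) (p : State (Fin m) K) : Val K :=
  .pair (restrictTo C fun i => .elt (p.1 i)) (restrictTo C fun i => .ofList (p.2 i))

theorem encodeState_restrict {K : Type} [Zero K] (C : Finset (Fin m)) (p : State (Fin m) K) :
    encodeState C (restrict C p) = encodeState C p :=
  congrArg₂ Val.pair (restrictTo_congr fun i hi => by simp [restrict, hi])
    (restrictTo_congr fun i hi => by simp [restrict, hi])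

end Encodings

section MessageCounts

variable {m : ℕ} [NeZero m]

theorem length_opening {K : Type} [Field K] (w : Fin m → K) (i : Fin m) :
    (opening w i).length =
      if i = 0 then ((List.finRange m).filter (· ≠ 0)).length else 1 := by
  unfold opening
  split_ifs
  · exact List.length_map _
  · rfl

theorem exists_length_mulState (i : Fin m) : ∃ n, ∀ {K : Type} [Field K]
    (r r' w w' c : Fin m → K), ((mulState r r' w w' c).2 i).length = n :=
  ⟨_, fun r r' w w' c => by simp only [mulState, List.length_append, List.length_cons,
    List.length_nil, length_opening]; rfl⟩

theorem length_simMul {K : Type} [Field K] [Fintype K] {C : Finset (Fin m)} {i : Fin m}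
    (hi : i ∈ C) {n : ℕ} (hn : ∀ r r' w w' c : Fin m → K, ((mulState r r' w w' c).2 i).length = n)
    {r r' : Fin m → K} {p : State (Fin m) K} (hp : p ∈ (simMul C r r').support) :
    (p.2 i).length = n := by
  simp only [simMul, PMF.mem_support_bind_iff, PMF.mem_support_map_iff] at hp
  obtain ⟨w, _, w', _, c, _, rfl⟩ := hp
  simp [restrict, hi, hn]

variable {F : ℕ → Type} [∀ κ, Field (F κ)] [∀ κ, Fintype (F κ)]

theorem exists_length_simEmulation {C : Finset (Fin m)} {i : Fin m} (hi : i ∈ C)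
    (φ : Formula (Literal F m)) : ∃ n, ∀ {κ} (o : CallOutputs φ κ),
      ∀ p ∈ (simEmulation C φ o).support, (p.2 i).length = n := by
  induction φ with
  | lit ℓ =>
    refine ⟨if i ∈ ℓ.parties then 2 else 0, fun o p hp => ?_⟩
    rw [simEmulation, PMF.support_pure, Set.mem_singleton_iff] at hp
    subst hp
    by_cases h : i ∈ ℓ.parties <;> simp [restrict, callState, hi, h]
  | and φ ψ ihφ ihψ =>
    obtain ⟨a, ha⟩ := ihφ
    obtain ⟨b, hb⟩ := ihψ
    refine ⟨a + b, fun o p hp => ?_⟩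
    rw [simEmulation, PMF.mem_support_map_iff] at hp
    obtain ⟨q, hq, rfl⟩ := hp
    obtain ⟨hq₁, hq₂⟩ := mem_support_prodLaw_iff.1 hq
    simp only [combine, List.length_append, ha _ _ hq₁, hb _ _ hq₂]
  | or φ ψ ihφ ihψ =>
    obtain ⟨a, ha⟩ := ihφ
    obtain ⟨b, hb⟩ := ihψ
    obtain ⟨c, hc⟩ := exists_length_mulState i
    refine ⟨a + b + c, fun o p hp => ?_⟩
    simp only [simEmulation, PMF.mem_support_bind_iff, PMF.mem_support_map_iff] at hp
    obtain ⟨q, hq, t, ht, rfl⟩ := hp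
    obtain ⟨hq₁, hq₂⟩ := mem_support_prodLaw_iff.1 hq
    simp only [receiveAfter, combine, List.length_append, ha _ _ hq₁, hb _ _ hq₂,
      length_simMul hi hc ht]

end MessageCounts

section SimulationPrograms

variable {m : ℕ} {F : ℕ → Type} [∀ κ, Field (F κ)] [∀ κ, Fintype (F κ)]
  {enc : ∀ κ, F κ ↪ List Bool} {ι : Type} {k : ι → ℕ} {e : ∀ a, Val (F (k a))}
  {C : Finset (Fin m)}

namespace ConstTimeComputable

theorem encodeState {p : ∀ a, State (Fin m) (F (k a))}
    (hshare : ∀ i ∈ C, ConstTimeComputable enc k e fun a => .elt ((p a).1 i))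
    (hview : ∀ i ∈ C, ConstTimeComputable enc k e fun a => .ofList ((p a).2 i)) :
    ConstTimeComputable enc k e fun a => encodeState C (p a) :=
  (restrictTo C hshare).pair (restrictTo C hview)

section Components

variable {p : ∀ a, State (Fin m) (F (k a))}
  (hp : ConstTimeComputable enc k e fun a => PZS.encodeState C (p a)) {i : Fin m} (hi : i ∈ C)
include hp hi

theorem share : ConstTimeComputable enc k e fun a => .elt ((p a).1 i) := of_restrictTo hp.fst hi

theorem messages : ConstTimeComputable enc k e fun a => .ofList ((p a).2 i) :=
  of_restrictTo hp.snd hi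

end Components

theorem combine {p q : ∀ a, State (Fin m) (F (k a))}
    (hn : ∀ i ∈ C, ∃ n, ∀ a, ((p a).2 i).length = n)
    (hp : ConstTimeComputable enc k e fun a => PZS.encodeState C (p a))
    (hq : ConstTimeComputable enc k e fun a => PZS.encodeState C (q a)) :
    ConstTimeComputable enc k e fun a => PZS.encodeState C (PZS.combine (p a) (q a)) := by
  refine encodeState (fun i hi => (hp.share hi).add (hq.share hi)) fun i hi => ?_
  obtain ⟨n, hn⟩ := hn i hi
  exact ofList_append hn (hp.messages hi) (hq.messages hi)

theorem receiveAfter {v : ∀ a, Fin m → List (Val (F (k a)))} {p : ∀ a, State (Fin m) (F (k a))}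
    (hn : ∀ i ∈ C, ∃ n, ∀ a, (v a i).length = n)
    (hv : ∀ i ∈ C, ConstTimeComputable enc k e fun a => .ofList (v a i))
    (hp : ConstTimeComputable enc k e fun a => PZS.encodeState C (p a)) :
    ConstTimeComputable enc k e fun a => PZS.encodeState C (PZS.receiveAfter (v a) (p a)) := by
  refine encodeState (fun i hi => hp.share hi) fun i hi => ?_
  obtain ⟨n, hn⟩ := hn i hi
  exact ofList_append hn (hv i hi) (hp.messages hi)

theorem callState {ℓ : Literal F m} {o : ∀ a, CallOutputs (.lit ℓ) (k a)}
    (ho : ConstTimeComputable enc k e fun a => encodeCalls C (.lit ℓ) (o a)) :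
    ConstTimeComputable enc k e fun a => PZS.encodeState C (PZS.callState ℓ (o a)) := by
  have houtput {i : Fin m} (hC : i ∈ C) (hi : i ∈ ℓ.parties) :
      ConstTimeComputable enc k e fun a => .pair (.elt (o a ⟨i, hi⟩).1) (o a ⟨i, hi⟩).2 :=
    of_restrictTo (w := fun a i => .pair (.elt (o a i).1) (o a i).2) ho
      (Literal.mem_inside (i := ⟨i, hi⟩).2 hC)
  refine encodeState (fun i hC => ?_) fun i hC => ?_ <;> by_cases hi : i ∈ ℓ.parties <;>
    simp only [PZS.callState, hi, dif_pos, dif_neg, not_false_eq_true]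
  · exact (houtput hC hi).fst
  · exact zero
  · exact (houtput hC hi).fst.pair ((houtput hC hi).snd.pair nil)
  · exact nil

variable [NeZero m]

theorem opening {w : ∀ a, Fin m → F (k a)}
    (hw : ∀ j, ConstTimeComputable enc k e fun a => .elt (w a j)) (i : Fin m) :
    ConstTimeComputable enc k e fun a => .ofList (PZS.opening (w a) i) := by
  unfold PZS.opening
  split_ifs
  · exact ofList_map _ fun j _ => hw j
  · exact (sum _ fun j _ => hw j).pair nil

theorem mulState {r r' w w' c : ∀ a, Fin m → F (k a)}
    (hr : ∀ i ∈ C, ConstTimeComputable enc k e fun a => .elt (r a i))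
    (hr' : ∀ i ∈ C, ConstTimeComputable enc k e fun a => .elt (r' a i))
    (hw : ∀ i, ConstTimeComputable enc k e fun a => .elt (w a i))
    (hw' : ∀ i, ConstTimeComputable enc k e fun a => .elt (w' a i))
    (hc : ∀ i, ConstTimeComputable enc k e fun a => .elt (c a i)) :
    ConstTimeComputable enc k e fun a =>
      PZS.encodeState C (PZS.mulState (r a) (r' a) (w a) (w' a) (c a)) := by
  have hd := sum Finset.univ fun i _ => hw i
  have he := sum Finset.univ fun i _ => hw' i
  refine encodeState (fun i hi => ?_) fun i hi => ?_
  · refine (((hc i).add (hd.mul ((hr' i hi).sub (hw' i)))).add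
      (he.mul ((hr i hi).sub (hw i)))).add ?_
    split_ifs
    · exact hd.mul he
    · exact zero
  · exact ((hr i hi).sub (hw i)).pair (((hr' i hi).sub (hw' i)).pair ((hc i).pair
      (ofList_append (fun _ => length_opening _ i) (opening hw i) (opening hw' i))))

theorem transView {r w b s : ∀ a, Fin m → F (k a)} {i : Fin m}
    (hr : ConstTimeComputable enc k e fun a => .elt (r a i))
    (hw : ∀ i, ConstTimeComputable enc k e fun a => .elt (w a i))
    (hb : ConstTimeComputable enc k e fun a => .elt (b a i))
    (hs : ConstTimeComputable enc k e fun a => .elt (s a i)) :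
    ConstTimeComputable enc k e fun a =>
      .ofList (PZS.transView (r a) (w a) (b a) (s a) i) :=
  ((hw i).sub hr).pair (hb.pair
    ((((sum Finset.univ fun i _ => hw i).mul hb).sub hs).pair (opening hw i)))

end ConstTimeComputable

namespace ConstTimeSamplable

variable [NeZero m]

theorem simMul {r r' : ∀ a, Fin m → F (k a)}
    (hr : ∀ i ∈ C, ConstTimeComputable enc k e fun a => .elt (r a i))
    (hr' : ∀ i ∈ C, ConstTimeComputable enc k e fun a => .elt (r' a i)) :
    ConstTimeSamplable enc k e fun a => (PZS.simMul C (r a) (r' a)).map (encodeState C) := by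
  refine ((uniform_sharesVal.prodLaw (uniform_sharesVal.prodLaw uniform_sharesVal)).map
    (g := fun a t => encodeState C (mulState (r a) (r' a) t.1 t.2.1 t.2.2)) ?_).congr fun a => ?_
  · exact .mulState (fun i hi => (hr i hi).weaken _) (fun i hi => (hr' i hi).weaken _)
      ConstTimeComputable.self.snd.fst.of_sharesVal
      ConstTimeComputable.self.snd.snd.fst.of_sharesVal
      ConstTimeComputable.self.snd.snd.snd.of_sharesVal
  · simp only [PZS.simMul, prodLaw_map, PMF.map_bind, PMF.map_comp,
      Function.comp_def, encodeState_restrict]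

theorem receiveAfter_simMul {v : ∀ a, Fin m → List (Val (F (k a)))} {r r' : ∀ a, Fin m → F (k a)}
    (hn : ∀ i ∈ C, ∃ n, ∀ a, (v a i).length = n)
    (hv : ∀ i ∈ C, ConstTimeComputable enc k e fun a => .ofList (v a i))
    (hr : ∀ i ∈ C, ConstTimeComputable enc k e fun a => .elt (r a i))
    (hr' : ∀ i ∈ C, ConstTimeComputable enc k e fun a => .elt (r' a i)) :
    ConstTimeSamplable enc k e fun a => (PZS.simMul C (r a) (r' a)).map fun p =>
      encodeState C (receiveAfter (v a) p) := by
  refine (simMul hr hr').map <| .receiveAfter (fun i hi => ?_)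
    (fun i hi => (hv i hi).weaken _) ConstTimeComputable.self.snd
  obtain ⟨n, hn⟩ := hn i hi
  exact ⟨n, fun a => hn a.1.1⟩

theorem simEmulation {φ : Formula (Literal F m)} {o : ∀ a, CallOutputs φ (k a)}
    (ho : ConstTimeComputable enc k e fun a => encodeCalls C φ (o a)) :
    ConstTimeSamplable enc k e fun a => (PZS.simEmulation C φ (o a)).map (encodeState C) := by
  induction φ with
  | lit ℓ =>
    simp only [PZS.simEmulation, PMF.pure_map, encodeState_restrict]
    exact ho.callState
  | and φ ψ ihφ ihψ =>
    simp only [PZS.simEmulation, PMF.map_comp]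
    refine ((ihφ ho.fst).prodLaw (ihψ ho.snd)).map
      (.combine (fun i hi => ?_) ConstTimeComputable.self.snd.fst ConstTimeComputable.self.snd.snd)
    obtain ⟨n, hn⟩ := exists_length_simEmulation hi φ
    exact ⟨n, fun p => hn _ _ (mem_support_prodLaw_iff.1 p.2).1⟩
  | or φ ψ ihφ ihψ =>
    simp only [PZS.simEmulation, PMF.map_bind, PMF.map_comp]
    refine ((ihφ ho.fst).prodLaw (ihψ ho.snd)).bind (receiveAfter_simMul (fun i hi => ?_)
      (fun i hi => .messages (.combine (fun i hi => ?_) ConstTimeComputable.self.snd.fst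
        ConstTimeComputable.self.snd.snd) hi)
      (fun i hi => ConstTimeComputable.self.snd.fst.share hi)
      (fun i hi => ConstTimeComputable.self.snd.snd.share hi))
    all_goals obtain ⟨n, hn⟩ := exists_length_simEmulation hi φ
    · obtain ⟨n', hn'⟩ := exists_length_simEmulation hi ψ
      refine ⟨n + n', fun p => ?_⟩
      rw [PZS.combine, List.length_append, hn _ _ (mem_support_prodLaw_iff.1 p.2).1,
        hn' _ _ (mem_support_prodLaw_iff.1 p.2).2]
    · exact ⟨n, fun p => hn _ _ (mem_support_prodLaw_iff.1 p.2).1⟩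

theorem view_simTransformation {x : ι → Fin m → Input} {v : ∀ a, Fin m → List (Val (F (k a)))}
    {r s : ∀ a, Fin m → F (k a)}
    (hn : ∀ i ∈ C, ∃ n, ∀ a, (v a i).length = n)
    (hx : ∀ i ∈ C, ConstTimeComputable enc k e fun a => .ofBits (x a i))
    (hv : ∀ i ∈ C, ConstTimeComputable enc k e fun a => .ofList (v a i))
    (hr : ∀ i ∈ C, ConstTimeComputable enc k e fun a => .elt (r a i))
    (hs : ∀ i ∈ C, ConstTimeComputable enc k e fun a => .elt (s a i)) :
    ConstTimeSamplable enc k e fun a => (simTransformation C (r a) (s a)).map fun w =>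
      restrictTo C fun i => .ofList (.ofBits (x a i) :: (v a i ++ w i)) := by
  refine ((uniform_sharesVal.prodLaw uniform_sharesVal).map (g := fun a t => restrictTo C fun i =>
    .ofList (.ofBits (x a i) :: (v a i ++ transView (r a) t.1 t.2 (s a) i)))
      (.restrictTo C fun i hi => ?_)).congr fun a => ?_
  · obtain ⟨n, hn⟩ := hn i hi
    exact ((hx i hi).weaken _).pair <| .ofList_append (fun a => hn a.1.1) ((hv i hi).weaken _) <|
      .transView ((hr i hi).weaken _) ConstTimeComputable.self.snd.fst.of_sharesVal
        (ConstTimeComputable.self.snd.snd.of_sharesVal i) ((hs i hi).weaken _)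
  · simp only [simTransformation, prodLaw_map, PMF.map_bind, PMF.map_comp, Function.comp_def]
    refine congrArg _ <| funext fun w => congrArg (PMF.map · _) <| funext fun b =>
      restrictTo_congr fun i hi => ?_
    rw [C.piecewise_eq_of_mem _ _ hi]

theorem simView {φ : Formula (Literal F m)} {o : ∀ a, CallOutputs φ (k a)}
    {x : ι → Fin m → Input} {s : ∀ a, Fin m → F (k a)}
    (ho : ConstTimeComputable enc k e fun a => encodeCalls C φ (o a))
    (hx : ∀ i ∈ C, ConstTimeComputable enc k e fun a => .ofBits (x a i))
    (hs : ∀ i ∈ C, ConstTimeComputable enc k e fun a => .elt (s a i)) :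
    ConstTimeSamplable enc k e fun a => (PZS.simView C (x a) φ (o a) (s a)).map fun v =>
      restrictTo C fun i => .ofList (v i) := by
  have htransformation := view_simTransformation (C := C) (enc := enc)
    (ι := {b : Σ a, State (Fin m) (F (k a)) // b.2 ∈ (PZS.simEmulation C φ (o b.1)).support})
    (k := fun b => k b.1.1) (e := fun b => .pair (e b.1.1) (encodeState C b.1.2))
    (x := fun b => x b.1.1) (v := fun b => b.1.2.2) (r := fun b => b.1.2.1) (s := fun b => s b.1.1)
    (fun i hi => (exists_length_simEmulation hi φ).imp fun n hn b => hn _ _ b.2)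
    (fun i hi => (hx i hi).weaken _) (fun i hi => ConstTimeComputable.self.snd.messages hi)
    (fun i hi => ConstTimeComputable.self.snd.share hi) fun i hi => (hs i hi).weaken _
  have hview : ConstTimeSamplable enc k e fun a => (PZS.simEmulation C φ (o a)).bind fun p =>
      (simTransformation C p.1 (s a)).map fun w =>
        restrictTo C fun i => .ofList (.ofBits (x a i) :: (p.2 i ++ w i)) :=
    (simEmulation ho).bind htransformation
  refine hview.congr fun a => ?_
  simp only [PZS.simView, PMF.map_bind, PMF.map_comp, Function.comp_def]
  refine congrArg _ <| funext fun p => congrArg (PMF.map · _) <| funext fun w =>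
    restrictTo_congr fun i hi => ?_
  rw [C.piecewise_eq_of_mem _ _ hi]

end ConstTimeSamplable

end SimulationPrograms

/-! ### Computational indistinguishability -/

section Indistinguishability

theorem Negligible.add {μ ν : ℕ → ℝ} (hμ : Negligible μ) (hν : Negligible ν) :
    Negligible fun κ => μ κ + ν κ := Asymptotics.SuperpolynomialDecay.add hμ hν

theorem Negligible.const_mul {μ : ℕ → ℝ} (hμ : Negligible μ) (c : ℝ) :
    Negligible fun κ => c * μ κ := Asymptotics.SuperpolynomialDecay.const_mul hμ c

theorem negligible_zero : Negligible fun _ => 0 :=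
  Asymptotics.superpolynomialDecay_zero _ _

theorem accept_map {K : Type} [Field K] [Fintype K] (enc : K ↪ List Bool) (D : Prog)
    (X : PMF (Val K)) (f : Val K → Val K) :
    D.accept enc (X.map f) = ((X.bind fun v => D.run enc (f v)) Val.tt).toReal := by
  rw [Prog.accept, PMF.bind_map, Function.comp_def]

variable {P : Type} [Fintype P] {F : ℕ → Type} [∀ κ, Field (F κ)] [∀ κ, Fintype (F κ)]
  {enc : ∀ κ, F κ ↪ List Bool} {X Y Z : (κ : ℕ) → (P → Input) → PMF (Val (F κ))}

namespace CompIndist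

theorem of_statistical (h : ∀ L : Polynomial ℕ, ∃ μ : ℕ → ℝ, Negligible μ ∧ ∀ κ x,
    inputSize Finset.univ x ≤ L.eval κ → ∀ (f : Val (F κ) → PMF (Val (F κ))) b,
      |((X κ x).bind f b).toReal - ((Y κ x).bind f b).toReal| ≤ μ κ) : CompIndist enc X Y := by
  intro D T L
  obtain ⟨μ, hμ, h⟩ := h L
  refine ⟨μ, hμ, fun κ x hx z _ => ?_⟩
  rw [accept_map, accept_map]
  exact h κ x hx _ _

theorem refl (X : (κ : ℕ) → (P → Input) → PMF (Val (F κ))) : CompIndist enc X X :=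
  .of_statistical fun _ => ⟨_, negligible_zero, fun κ x _ f b => by rw [sub_self, abs_zero]⟩

theorem trans (h : CompIndist enc X Y) (h' : CompIndist enc Y Z) : CompIndist enc X Z := by
  intro D T L
  obtain ⟨μ, hμ, h⟩ := h D T L
  obtain ⟨ν, hν, h'⟩ := h' D T L
  exact ⟨_, hμ.add hν, fun κ x hx z hz =>
    (abs_sub_le _ _ _).trans (add_le_add (h κ x hx z hz) (h' κ x hx z hz))⟩

theorem congr {X' Y' : (κ : ℕ) → (P → Input) → PMF (Val (F κ))} (h : CompIndist enc X Y)
    (hX : ∀ κ x, X κ x = X' κ x) (hY : ∀ κ x, Y κ x = Y' κ x) : CompIndist enc X' Y' := by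
  rwa [← funext₂ hX, ← funext₂ hY]

theorem comp_parties {P' : Type} [Fintype P'] (h : CompIndist enc X Y) (r : P → P')
    (hr : ∀ x : P' → Input,
      inputSize Finset.univ (fun i => x (r i)) ≤ inputSize Finset.univ x) :
    CompIndist enc (fun κ (x : P' → Input) => X κ fun i => x (r i))
      fun κ x => Y κ fun i => x (r i) := by
  intro D T L
  obtain ⟨μ, hμ, h⟩ := h D T L
  exact ⟨μ, hμ, fun κ x hx z hz => h κ _ ((hr x).trans hx) z hz⟩

end CompIndist

theorem ConstTimeSamplable.keep_advice {f : ∀ κ, Val (F κ) → Val (F κ) → PMF (Val (F κ))}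
    (hf : ConstTimeSamplable enc (ι := Σ κ, Val (F κ) × Val (F κ)) (fun a => a.1)
      (fun a => .pair a.2.1 a.2.2) fun a => f a.1 a.2.1 a.2.2) :
    ConstTimeSamplable enc (ι := Σ κ, Val (F κ) × Val (F κ) × Val (F κ)) (fun a => a.1)
      (fun a => .pair (.unary a.1) (.pair (.pair a.2.1 a.2.2.1) a.2.2.2)) fun a =>
        (f a.1 a.2.2.1 a.2.2.2).map fun r => .pair (.unary a.1) (.pair a.2.1 r) := by
  have hinput := ConstTimeComputable.self (enc := enc)
    (ι := Σ κ, Val (F κ) × Val (F κ) × Val (F κ)) (k := fun a => a.1)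
    (e := fun a => .pair (.unary a.1) (.pair (.pair a.2.1 a.2.2.1) a.2.2.2))
  have hprocess := (hinput.snd.fst.snd.pair hinput.snd.snd).comp_samplable
    <| hf.reindex
    fun a : Σ κ, Val (F κ) × Val (F κ) × Val (F κ) => ⟨a.1, a.2.2.1, a.2.2.2⟩
  refine (ConstTimeSamplable.pair hinput.fst
    (ConstTimeSamplable.pair hinput.snd.fst.fst hprocess)).congr fun a => ?_
  simp only [PMF.pure_bind, PMF.map_comp, Function.comp_def]

namespace CompIndist

/-- The auxiliary data `W` need not be efficiently samplable: their best value can be given to the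
distinguisher as a part of its advice. -/
theorem process (h : CompIndist enc X Y) (W : (κ : ℕ) → (P → Input) → PMF (Val (F κ)))
    {f : ∀ κ, Val (F κ) → Val (F κ) → PMF (Val (F κ))}
    (hf : ConstTimeSamplable enc (ι := Σ κ, Val (F κ) × Val (F κ)) (fun a => a.1)
      (fun a => .pair a.2.1 a.2.2) fun a => f a.1 a.2.1 a.2.2) :
    CompIndist enc (fun κ x => (W κ x).bind fun w => (X κ x).bind (f κ w))
      fun κ x => (W κ x).bind fun w => (Y κ x).bind (f κ w) := by
  obtain ⟨A, c, hc, hA⟩ := hf.keep_advice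
  intro D T L
  obtain ⟨μ, hμ, h⟩ := h (.seq A D) (Polynomial.C c + T + 1) L
  refine ⟨μ, hμ, fun κ x hx z hz => ?_⟩
  have hrun (w v) : (Prog.seq A D).run (enc κ) (.pair (.unary κ) (.pair (.pair z w) v)) =
      (f κ w v).bind fun r => D.run (enc κ) (.pair (.unary κ) (.pair z r)) := by
    rw [run_seq, hA ⟨κ, z, w, v⟩, PMF.bind_map, Function.comp_def]
  have hcost (w v) : (Prog.seq A D).CostLE (enc κ) (.pair (.unary κ) (.pair (.pair z w) v))
      ((Polynomial.C c + T + 1).eval κ) := by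
    rw [Polynomial.eval_add, Polynomial.eval_add, Polynomial.eval_one, Polynomial.eval_C]
    refine costLE_seq (hc _ _) fun u hu => ?_
    rw [hA ⟨κ, z, w, v⟩, PMF.mem_support_map_iff] at hu
    obtain ⟨r, _, rfl⟩ := hu
    exact hz r
  simp only [accept_map, PMF.bind_bind]
  refine abs_bind_sub_bind_le _ fun w => ?_
  simpa only [accept_map, hrun] using h κ x hx (.pair z w) (hcost w)

theorem pair {X' Y' : (κ : ℕ) → (P → Input) → PMF (Val (F κ))} (h : CompIndist enc X Y)
    (h' : CompIndist enc X' Y') :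
    CompIndist enc (fun κ x => (X κ x).bind fun v => (X' κ x).map (.pair v))
      fun κ x => (Y κ x).bind fun v => (Y' κ x).map (.pair v) := by
  have hleft : CompIndist enc (fun κ x => (X κ x).bind fun v => (X' κ x).map (.pair v))
      fun κ x => (Y κ x).bind fun v => (X' κ x).map (.pair v) :=
    (h.process X' (f := fun _ w v => PMF.pure (.pair v w))
      (ConstTimeComputable.self.snd.pair ConstTimeComputable.self.fst)).congr
        (fun κ x => PMF.bind_comm _ _ _) fun κ x => PMF.bind_comm _ _ _
  exact hleft.trans (h'.process Y (f := fun _ w v => PMF.pure (.pair w v)) ConstTimeComputable.self)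

end CompIndist

end Indistinguishability

/-! ### Simulators -/

section Simulators

variable {P : Type} [Fintype P] [LinearOrder P] {F : ℕ → Type} [∀ κ, Field (F κ)]
  [∀ κ, Fintype (F κ)] {enc : ∀ κ, F κ ↪ List Bool}

section Components

variable {ι : Type} {k : ι → ℕ} {e : ∀ a, Val (F (k a))} {C : Finset P} {x : ι → P → Input}

namespace ConstTimeComputable

variable {s : ∀ a, P → F (k a)}
  (h : ConstTimeComputable enc k e fun a => simInput (k a) C (x a) (s a))
include h

theorem securityParameter_of_simInput : ConstTimeComputable enc k e fun a => .unary (k a) := h.fst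

theorem input_of_simInput {i : P} (hi : i ∈ C) :
    ConstTimeComputable enc k e fun a => .ofBits (x a i) := (of_restrictTo h.snd hi).fst

theorem share_of_simInput {i : P} (hi : i ∈ C) :
    ConstTimeComputable enc k e fun a => .elt (s a i) := (of_restrictTo h.snd hi).snd

end ConstTimeComputable

variable (hk : ConstTimeComputable enc k e fun a => .unary (k a))
include hk

theorem PolyTimeFunctionality.polyTimeSamplable
    {G : (κ : ℕ) → (P → Input) → PMF (P → F κ × Val (F κ))} (hG : PolyTimeFunctionality enc G)
    (hx : ∀ i, ConstTimeComputable enc k e fun a => .ofBits (x a i)) :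
    PolyTimeSamplable enc k e (fun a => k a + inputSize Finset.univ (x a)) fun a =>
      (G (k a) (x a)).map fun o =>
        restrictTo Finset.univ fun i => .pair (.elt (o i).1) (o i).2 := by
  obtain ⟨g, T, hg⟩ := hG
  exact (hk.pair (.restrictTo _ fun i _ => hx i)).comp_polyTimeSamplable
    ⟨g, T, fun a => hg (k a) (x a)⟩

namespace PolyTimeSim

variable {Sim : Prog} (hSim : PolyTimeSim (P := P) enc Sim)
  (hx : ∀ i ∈ C, ConstTimeComputable enc k e fun a => .ofBits (x a i))
include hSim hx

theorem polyTimeSamplable {s : ∀ a, P → F (k a)}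
    (hs : ∀ i ∈ C, ConstTimeComputable enc k e fun a => .elt (s a i)) :
    PolyTimeSamplable enc k e (fun a => k a + inputSize C (x a)) fun a =>
      Sim.run (enc (k a)) (simInput (k a) C (x a) (s a)) := by
  obtain ⟨T, hT⟩ := hSim
  exact (hk.pair (.restrictTo C fun i hi => (hx i hi).pair (hs i hi))).comp_polyTimeSamplable
    ⟨Sim, T, fun a => ⟨hT _ _ _ _, rfl⟩⟩

theorem polyTimeSamplable_uniform :
    PolyTimeSamplable enc k e (fun a => k a + inputSize C (x a)) fun a =>
      (PMF.uniformOfFintype (P → F (k a))).bind fun s =>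
        Sim.run (enc (k a)) (simInput (k a) C (x a) s) :=
  ConstTimeSamplable.uniform_sharesVal.polyTimeSamplable.bind <|
    hSim.polyTimeSamplable (hk.weaken _) (fun i hi => (hx i hi).weaken _) fun i _ =>
      ConstTimeComputable.self.snd.of_sharesVal i

end PolyTimeSim

end Components

/-- The ensemble `X` can be sampled by a simulator for the coalition `C`, which is given the
security parameter and the inputs and shares of `C` and runs in polynomial time. -/
def CoalitionSamplable (enc : ∀ κ, F κ ↪ List Bool) (C : Finset P)
    (X : (κ : ℕ) → (P → Input) → (P → F κ) → PMF (Val (F κ))) : Prop :=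
  PolyTimeSamplable enc (ι := Σ κ, (P → Input) × (P → F κ)) (fun a => a.1)
    (fun a => simInput a.1 C a.2.1 a.2.2) (fun a => a.1 + inputSize C a.2.1)
    fun a => X a.1 a.2.1 a.2.2

/-- The ensemble `Y` is computationally indistinguishable from one that a simulator for the
coalition `C` can sample from the inputs of `C` alone. -/
def IsSimulable (enc : ∀ κ, F κ ↪ List Bool) (C : Finset P)
    (Y : (κ : ℕ) → (P → Input) → PMF (Val (F κ))) : Prop :=
  ∃ X, CoalitionSamplable enc C (fun κ x _ => X κ x) ∧ CompIndist enc X Y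

theorem IsSimulable.pair {C : Finset P} {Y Y' : (κ : ℕ) → (P → Input) → PMF (Val (F κ))}
    (h : IsSimulable enc C Y) (h' : IsSimulable enc C Y') :
    IsSimulable enc C fun κ x => (Y κ x).bind fun v => (Y' κ x).map (.pair v) := by
  obtain ⟨X, hX, hXY⟩ := h
  obtain ⟨X', hX', hXY'⟩ := h'
  exact ⟨fun κ x => (X κ x).bind fun v => (X' κ x).map (.pair v), hX.pair hX', hXY.pair hXY'⟩

theorem exists_polyTimeSim {X : Finset P → (κ : ℕ) → (P → Input) → (P → F κ) → PMF (Val (F κ))}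
    (h : ∀ C, CoalitionSamplable enc C (X C)) : ∃ Sim, PolyTimeSim (P := P) enc Sim ∧
      ∀ κ C x s, Sim.run (enc κ) (simInput κ C x s) = X C κ x s := by
  have hall : PolyTimeSamplable enc (ι := Σ κ, Finset P × (P → Input) × (P → F κ)) (fun a => a.1)
      (fun a => simInput a.1 a.2.1 a.2.2.1 a.2.2.2) (fun a => a.1 + inputSize a.2.1 a.2.2.1)
      fun a => X a.2.1 a.1 a.2.2.1 a.2.2.2 := by
    refine .cases_finset (C := fun a => a.2.1) (fun i =>
      ⟨_, ConstTimeComputable.self.snd.restrictTo_entry i, fun a => ?_⟩) fun C => ?_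
    · by_cases hi : i ∈ a.2.1 <;> simp [hi, Val.ofOption]
    · obtain ⟨p, T, hp⟩ := h C
      refine ⟨p, T, ?_⟩
      rintro ⟨⟨κ, C, x, s⟩, rfl⟩
      exact hp ⟨κ, x, s⟩
  obtain ⟨Sim, T, hSim⟩ := hall
  exact ⟨Sim, ⟨T, fun κ C x s => (hSim ⟨κ, C, x, s⟩).1⟩, fun κ C x s => (hSim ⟨κ, C, x, s⟩).2⟩

end Simulators

/-! ### Security -/

section Security

variable {m : ℕ} {F : ℕ → Type}

theorem Literal.inside_univ (ℓ : Literal F m) : ℓ.inside Finset.univ = Finset.univ :=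
  Finset.eq_univ_of_forall fun _ => Literal.mem_inside.2 (Finset.mem_univ _)

theorem Literal.inputSize_inside_le (ℓ : Literal F m) (C : Finset (Fin m)) (x : Fin m → Input) :
    inputSize (ℓ.inside C) (fun i => x i) ≤ inputSize C x := by
  unfold inputSize Literal.inside
  rw [Finset.sum_subtype_eq_sum_filter (f := fun i => (x i).length)]
  exact Finset.sum_le_sum_of_subset (Finset.filter_subset _ _)

theorem Literal.inputSize_parties_le (ℓ : Literal F m) (x : Fin m → Input) :
    inputSize Finset.univ (fun i : ℓ.parties => x i) ≤ inputSize Finset.univ x :=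
  ℓ.inside_univ ▸ ℓ.inputSize_inside_le Finset.univ x

variable [∀ κ, Field (F κ)] [∀ κ, Fintype (F κ)] {enc : ∀ κ, F κ ↪ List Bool}
  {C : Finset (Fin m)}

theorem isSimulable_call_of_inside_eq_univ {ℓ : Literal F m}
    (hℓ : PolyTimeFunctionality enc ℓ.func) (hC : ℓ.inside C = Finset.univ) :
    IsSimulable enc C fun κ x => (callLaw κ x (.lit ℓ)).map (encodeCalls C (.lit ℓ)) := by
  refine ⟨_, ?_, .refl _⟩
  have hinput := ConstTimeComputable.self (enc := enc) (ι := Σ κ, (Fin m → Input) × (Fin m → F κ))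
    (k := fun a => a.1) (e := fun a => simInput a.1 C a.2.1 a.2.2)
  have hrun := hℓ.polyTimeSamplable (x := fun a i => a.2.1 i) hinput.securityParameter_of_simInput
    fun i => hinput.input_of_simInput (Literal.mem_inside.1 (hC ▸ Finset.mem_univ (i : ℓ.parties)))
  refine (hrun.mono fun a => ?_).congr fun a => ?_
  · rw [← hC]
    exact Nat.add_le_add_left (ℓ.inputSize_inside_le C _) _
  · simp only [callLaw, encodeCalls, hC]
    rfl

theorem isSimulable_call_of_inside_ne_univ {ℓ : Literal F m}
    (hℓ : IsRelaxedPZS enc ℓ.pred ℓ.func) (hC : ℓ.inside C ≠ Finset.univ) :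
    IsSimulable enc C fun κ x => (callLaw κ x (.lit ℓ)).map (encodeCalls C (.lit ℓ)) := by
  obtain ⟨S, hS, hpriv⟩ := hℓ.priv
  refine ⟨fun κ x => (PMF.uniformOfFintype (ℓ.parties → F κ)).bind fun s =>
    S.run (enc κ) (simInput κ (ℓ.inside C) (fun i => x i) s), ?_, ?_⟩
  · have hinput := ConstTimeComputable.self (enc := enc) (ι := Σ κ, (Fin m → Input) × (Fin m → F κ))
      (k := fun a => a.1) (e := fun a => simInput a.1 C a.2.1 a.2.2)
    have hrun := hS.polyTimeSamplable_uniform (C := ℓ.inside C) (x := fun a i => a.2.1 i)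
      hinput.securityParameter_of_simInput fun i hi =>
        hinput.input_of_simInput (Literal.mem_inside.1 hi)
    exact hrun.mono fun a => Nat.add_le_add_left (ℓ.inputSize_inside_le C _) _
  · refine ((hpriv _ hC).comp_parties (fun i => (i : Fin m)) ℓ.inputSize_parties_le).congr
      (fun κ x => idealPZS_bind_of_dependsOn hC (fun s s' hs => ?_) _) fun κ x => rfl
    have hinput : simInput κ (ℓ.inside C) (fun i => x i) s =
        simInput κ (ℓ.inside C) (fun i => x i) s' :=
      congrArg (Val.pair _) (restrictTo_congr fun i hi => by rw [hs i hi])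
    rw [hinput]

theorem isSimulable_calls {φ : Formula (Literal F m)}
    (hφ : ∀ ℓ ∈ φ.literals, IsRelaxedPZS enc ℓ.pred ℓ.func) (C : Finset (Fin m)) :
    IsSimulable enc C fun κ x => (callLaw κ x φ).map (encodeCalls C φ) := by
  induction φ with
  | lit ℓ =>
    have hℓ := hφ ℓ (List.mem_singleton_self ℓ)
    by_cases hC : ℓ.inside C = Finset.univ
    · exact isSimulable_call_of_inside_eq_univ hℓ.polyTime hC
    · exact isSimulable_call_of_inside_ne_univ hℓ hC
  | and φ ψ ihφ ihψ | or φ ψ ihφ ihψ =>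
    have hpair := (ihφ fun ℓ h => hφ ℓ (List.mem_append_left _ h)).pair
      (ihψ fun ℓ h => hφ ℓ (List.mem_append_right _ h))
    convert hpair using 3 with κ x
    refine (prodLaw_map (callLaw κ x φ) (callLaw κ x ψ) _).trans ?_
    simp only [encodeCalls, PMF.bind_map, PMF.map_comp, Function.comp_def]

end Security

section Hybrid

variable {m : ℕ} {F : ℕ → Type} [∀ κ, Field (F κ)] [∀ κ, Fintype (F κ)] {enc : ∀ κ, F κ ↪ List Bool}
  {φ : Formula (Literal F m)}

theorem exists_negligible_error (hφ : ∀ ℓ ∈ φ.literals, IsRelaxedPZS enc ℓ.pred ℓ.func)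
    (L : Polynomial ℕ) : ∃ μ : ℕ → ℝ, Negligible μ ∧ ∀ κ (x : Fin m → Input),
      inputSize Finset.univ x ≤ L.eval κ → (φ.literals.map fun ℓ => ℓ.error κ x).sum ≤ μ κ := by
  generalize φ.literals = l at hφ
  induction l with
  | nil => exact ⟨_, negligible_zero, fun κ x _ => by rw [List.map_nil, List.sum_nil]⟩
  | cons ℓ l ih =>
    obtain ⟨μ, hμ, h⟩ := ih fun ℓ' h => hφ ℓ' (List.mem_cons_of_mem ℓ h)
    obtain ⟨ν, hν, h'⟩ := (hφ ℓ List.mem_cons_self).correct L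
    refine ⟨_, hν.add hμ, fun κ x hx => ?_⟩
    rw [List.map_cons, List.sum_cons]
    exact add_le_add (h' κ _ ((ℓ.inputSize_parties_le x).trans hx)) (h κ x hx)

theorem toOuterMeasure_secret_wrong_le_error {s κ : ℕ} (hF : 2 ^ s ≤ Fintype.card (F κ))
    (hOr : φ.numOr * 2 ^ s ≤ Fintype.card (F κ)) (x : Fin m → Input) :
    ((callLaw κ x φ).toOuterMeasure {o | ¬(secret φ o = 0 ↔ φ.pred x)}).toReal ≤
      (φ.literals.map fun ℓ => ℓ.error κ x).sum + 2 * (2 : ℝ)⁻¹ ^ s := by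
  have hwrong := toOuterMeasure_secret_wrong_le κ x φ
  have hsecret := tvDist_secret_le κ x φ
  have hnumOr := natCast_mul_inv_le_inv_pow hOr
  have hcard := natCast_mul_inv_le_inv_pow ((one_mul _).trans_le hF)
  rw [Nat.cast_one, one_mul] at hcard
  linarith

variable [NeZero m] {C : Finset (Fin m)}

/-- The ensemble between the ideal and the real one: the outputs are ideal shares for the predicate
of `φ`, whereas the view of `C` is simulated from the actual results of the calls. -/
noncomputable def hybrid (C : Finset (Fin m)) (φ : Formula (Literal F m)) (κ : ℕ)
    (x : Fin m → Input) : PMF (Val (F κ)) :=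
  (idealPZS (φ.pred x)).bind fun s => (callLaw κ x φ).bind fun o =>
    (simView C x φ o s).map fun v => .pair (restrictTo C fun i => .ofList (v i)) (sharesVal s)

theorem protocol_map_restrictTo_view (hC : C ≠ Finset.univ) (κ : ℕ) (x : Fin m → Input)
    (φ : Formula (Literal F m)) :
    ((protocol φ κ x).map fun o =>
        Val.pair (restrictTo C fun i => .ofList (o.1 i)) (sharesVal o.2)) =
      (callLaw κ x φ).bind fun o => (idealPZS (secret φ o = 0)).bind fun s =>
        (simView C x φ o s).map fun v =>
          Val.pair (restrictTo C fun i => .ofList (v i)) (sharesVal s) := by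
  have h := congrArg (PMF.map fun p =>
    Val.pair (restrictTo C fun i => .ofList (p.2 i)) (sharesVal p.1)) (protocol_map_view hC κ x φ)
  have hrestrict (v : Fin m → List (Val (F κ))) :
      restrictTo C (fun i => .ofList (C.piecewise v (fun _ => []) i)) =
        restrictTo C fun i => .ofList (v i) :=
    restrictTo_congr fun i hi => by rw [C.piecewise_eq_of_mem _ _ hi]
  simpa only [PMF.map_comp, PMF.map_bind, Function.comp_def, hrestrict] using h

theorem hybrid_compIndist_protocol (hC : C ≠ Finset.univ)
    (hφ : ∀ ℓ ∈ φ.literals, IsRelaxedPZS enc ℓ.pred ℓ.func)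
    {σ : ℕ → ℕ} (hσ : Negligible fun κ => (2 : ℝ)⁻¹ ^ σ κ)
    (hF : ∀ κ, 2 ^ σ κ ≤ Fintype.card (F κ))
    (hOr : ∀ κ, φ.numOr * 2 ^ σ κ ≤ Fintype.card (F κ)) :
    CompIndist enc (hybrid C φ) fun κ x => (protocol φ κ x).map fun o =>
      .pair (restrictTo C fun i => .ofList (o.1 i)) (sharesVal o.2) := by
  refine .of_statistical fun L => ?_
  obtain ⟨μ, hμ, hle⟩ := exists_negligible_error hφ L
  refine ⟨_, hμ.add (hσ.const_mul 2), fun κ x hx f b => ?_⟩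
  rw [protocol_map_restrictTo_view hC, hybrid, PMF.bind_comm, PMF.bind_bind, PMF.bind_bind]
  refine (abs_bind_sub_bind_le_toOuterMeasure _ (fun o ho => ?_) b).trans
    ((toOuterMeasure_secret_wrong_le_error (hF κ) (hOr κ) x).trans (add_le_add (hle κ x hx) le_rfl))
  rw [propext (not_not.1 ho)]

theorem exists_coalitionSamplable_compIndist_hybrid
    (hφ : ∀ ℓ ∈ φ.literals, IsRelaxedPZS enc ℓ.pred ℓ.func) (C : Finset (Fin m)) :
    ∃ X, CoalitionSamplable enc C X ∧ CompIndist enc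
      (fun κ x => (idealPZS (φ.pred x)).bind fun s =>
        (X κ x s).map fun w => .pair w (sharesVal s)) (hybrid C φ) := by
  obtain ⟨Y, hY, hYφ⟩ := isSimulable_calls hφ C
  have hinput := ConstTimeComputable.self (enc := enc)
    (ι := Σ κ, CallOutputs φ κ × (Fin m → Input) × (Fin m → F κ)) (k := fun a => a.1)
    (e := fun a => .pair (simInput a.1 C a.2.2.1 a.2.2.2) (encodeCalls C φ a.2.1))
  obtain ⟨A, c, hc, hA⟩ := ConstTimeSamplable.simView hinput.snd
    (fun i hi => hinput.fst.input_of_simInput hi) fun i hi => hinput.fst.share_of_simInput hi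
  refine ⟨fun κ x s => (Y κ x).bind fun v => A.run (enc κ) (.pair (simInput κ C x s) v), ?_, ?_⟩
  · exact PolyTimeSamplable.bind (e' := fun _ v => v) (hY.congr fun a => (PMF.map_id _).symm)
      (ConstTimeSamplable.polyTimeSamplable ⟨A, c, hc, fun _ => rfl⟩)
  · have hrun : ConstTimeSamplable enc (ι := Σ κ, Val (F κ) × Val (F κ)) (fun a => a.1)
        (fun a => .pair a.2.1 a.2.2) fun a =>
          (A.run (enc a.1) (.pair a.2.1.head a.2.2)).map fun r => .pair r a.2.1.tail := by
      have hdata := ConstTimeComputable.self (enc := enc) (ι := Σ κ, Val (F κ) × Val (F κ))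
        (k := fun a => a.1) (e := fun a => .pair a.2.1 a.2.2)
      refine (ConstTimeSamplable.pair ((hdata.fst.head.pair hdata.snd).comp_samplable
        ⟨A, c, hc, fun _ => rfl⟩) hdata.fst.tail).congr fun a => ?_
      simp only [PMF.pure_map]
      rfl
    refine (hYφ.process (fun κ x => (idealPZS (φ.pred x)).map fun s =>
      .pair (simInput κ C x s) (sharesVal s)) (f := fun κ w v =>
        (A.run (enc κ) (.pair w.head v)).map fun r => .pair r w.tail) hrun).congr
          (fun κ x => ?_) fun κ x => ?_
    · simp only [PMF.bind_map, PMF.map_bind]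
      rfl
    · simp only [hybrid, PMF.bind_map, Function.comp_def]
      refine congrArg _ <| funext fun s => congrArg _ <| funext fun o => ?_
      exact (congrArg (PMF.map _) (hA ⟨κ, o, x, s⟩)).trans (PMF.map_comp _ _ _)

theorem exists_simulator (hφ : ∀ ℓ ∈ φ.literals, IsRelaxedPZS enc ℓ.pred ℓ.func) :
    ∃ Sim : Prog, PolyTimeSim (P := Fin m) enc Sim ∧ ∀ C : Finset (Fin m), CompIndist enc
      (fun κ x => (idealPZS (φ.pred x)).bind fun s =>
        (Sim.run (enc κ) (simInput κ C x s)).map fun w => .pair w (sharesVal s)) (hybrid C φ) := by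
  choose X hX hXφ using exists_coalitionSamplable_compIndist_hybrid hφ
  obtain ⟨Sim, hSim, hrun⟩ := exists_polyTimeSim hX
  simp only [← hrun] at hXφ
  exact ⟨Sim, hSim, hXφ⟩

end Hybrid

end PZS

open PZS in
theorem mainTheorem4 {m : ℕ} [NeZero m] (hm : 2 ≤ m)
    (F : ℕ → Type) [∀ κ, Field (F κ)] [∀ κ, Fintype (F κ)] (enc : ∀ κ, F κ ↪ List Bool)
    (φ : Formula (Literal F m))
    (hφ : ∀ ℓ ∈ φ.literals, IsRelaxedPZS enc ℓ.pred ℓ.func)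
    (σ : ℕ → ℕ) (hσ : Negligible fun κ => (2 : ℝ)⁻¹ ^ σ κ)
    (hF : ∀ κ, 2 ^ σ κ ≤ Fintype.card (F κ))
    (hOr : ∀ κ, φ.numOr * 2 ^ σ κ ≤ Fintype.card (F κ)) :
    SecurelyRealizesPZS enc φ.pred (protocol φ) ∧
      ∀ κ (x : Fin m → Input),
        tvDist ((emulation κ x φ).map fun o => ∑ i, o.1 i) (idealSecret (φ.pred x)) ≤
            (φ.literals.map fun ℓ => ℓ.error κ x).sum + (2 : ℝ)⁻¹ ^ σ κ ∧
          tvDist ((protocol φ κ x).map fun o => o.2) (idealPZS (φ.pred x)) ≤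
            (φ.literals.map fun ℓ => ℓ.error κ x).sum + 2 * (2 : ℝ)⁻¹ ^ σ κ := by
  refine ⟨?_, fun κ x => ?_⟩
  · obtain ⟨Sim, hSim, hideal⟩ := exists_simulator hφ
    exact ⟨Sim, hSim, fun C hC => (hideal C).trans (hybrid_compIndist_protocol hC hφ hσ hF hOr)⟩
  · have hsecret := tvDist_secret_le κ x φ
    have houtput := tvDist_output_le κ x φ
    have hnumOr := natCast_mul_inv_le_inv_pow (hOr κ)
    have hcard := natCast_mul_inv_le_inv_pow ((one_mul _).trans_le (hF κ))
    rw [Nat.cast_one, one_mul] at hcard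
    rw [emulation_map_sum]
    constructor <;> linarith
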